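/- Fix an integer $d\ge 3$ and a real number $\lambda<d$. For a $d$-regular graph $G$ on $n$ vertices, let $d=\lambda_1\ge\lambda_2\ge\dots\ge\lambda_n$ be the eigenvalues of its adjacency matrix, with multiplicity, and let $\lambda(G)=\max_{i\ge 2}|\lambda_i|=\max\{\lambda_2,|\lambda_n|\}$ be its second largest eigenvalue in absolute value. A non-backtracking random walk of length $k$ on $G$ from a vertex $w_0$ is a uniformly chosen member of the set of all sequences $(w_0,w_1,\dots,w_k)$ of vertices such that $w_{t-1}w_t$ is an edge for $1\le t\le k$ and $w_{t-1}\ne w_{t+1}$ for $1\le t\le k-1$. There are sequences $\delta_n\to 0$ and $\eta_n\to 0$, depending only on $d$ and $\lambda$, such that the following holds for every $n$, every finite simple $d$-regular graph $G=(V,E)$ on $n$ vertices with $\lambda(G)\le\lambda$ and girth at least $10\log_{d-1}\log n$, and every starting vertex $w_0\in V$. If $(w_0,w_1,\dots,w_n)$ is a non-backtracking random walk of length $n$ on $G$ from $w_0$, and $M=\max_{v\in V}|\{t\in\{0,\dots,n\}: w_t=v\}|$ is the maximal number of its visits to a single vertex, then $$\Pr\left[(1-\delta_n)\frac{\log n}{\log\log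 n}\le M\le(1+\delta_n)\frac{\log n}{\log\log n}\right]\ge 1-\eta_n .$$ That is, with high probability $M=(1+o(1))\frac{\log n}{\log\log n}$ as $n\to\infty$. -/

import Mathlib

lemma adjMatrix_isHermitian {V : Type*} (G : SimpleGraph V) [DecidableRel G.Adj] :
    (G.adjMatrix ℝ).IsHermitian := by
  ext i j
  simp [Matrix.conjTranspose_apply, SimpleGraph.adjMatrix_apply, G.adj_comm]

/-- `G` is an `(n, d, lam)`-graph, where `n` is the number of vertices: it is `d`-regular,
`lam < d`, and `lam` is the second largest absolute value of an eigenvalue. The eigenvalues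
`λ₁ ≥ λ₂ ≥ … ≥ λₙ` of the adjacency matrix, listed with multiplicity, are `eigenvalues₀ 0`,
`eigenvalues₀ 1`, …; `lam` is the maximum of `|λᵢ|` over `i ≥ 2`,
that is `max {λ₂, |λₙ|}`. -/
def IsNDLGraph {V : Type*} [Fintype V] [DecidableEq V] (G : SimpleGraph V)
    [DecidableRel G.Adj] (n d : ℕ) (lam : ℝ) : Prop :=
  Fintype.card V = n ∧ G.IsRegularOfDegree d ∧ lam < d ∧
    IsGreatest
      {x : ℝ | ∃ i : Fin (Fintype.card V), 0 < (i : ℕ) ∧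
        x = |(adjMatrix_isHermitian G).eigenvalues₀ i|} lam

/-- `(w 0, …, w k)` is a non-backtracking walk of length `k` in `G` that starts at `w₀`. -/
def IsNonBacktrackingWalk {V : Type*} (G : SimpleGraph V) (w₀ : V) (k : ℕ)
    (w : Fin (k + 1) → V) : Prop :=
  w 0 = w₀ ∧
    (∀ s t : Fin (k + 1), (t : ℕ) = s + 1 → G.Adj (w s) (w t)) ∧
    (∀ s t : Fin (k + 1), (t : ℕ) = s + 2 → w s ≠ w t)

open Classical in
/-- The finite set of all non-backtracking walks of length `k` from `w₀`. -/
noncomputable def nonBacktrackingWalks {V : Type*} [Fintype V] (G : SimpleGraph V)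
    (w₀ : V) (k : ℕ) : Finset (Fin (k + 1) → V) :=
  Finset.univ.filter (IsNonBacktrackingWalk G w₀ k)

open Classical in
/-- The probability that a non-backtracking random walk of length `k` from `w₀`, that is, a
uniformly chosen member of `nonBacktrackingWalks G w₀ k`, has the property `A`. -/
noncomputable def nonBacktrackingProb {V : Type*} [Fintype V] (G : SimpleGraph V)
    (w₀ : V) (k : ℕ) (A : (Fin (k + 1) → V) → Prop) : ℝ :=
  (((nonBacktrackingWalks G w₀ k).filter A).card : ℝ) / ((nonBacktrackingWalks G w₀ k).card : ℝ)

/-- The number of visits of the walk `(w 0, …, w k)` to the vertex `v`. -/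
def visits {V : Type*} [DecidableEq V] {k : ℕ} (w : Fin (k + 1) → V) (v : V) : ℕ :=
  (Finset.univ.filter fun t => w t = v).card

/-- The maximal number of visits of the walk `(w 0, …, w k)` to a single vertex. -/
def maxVisits {V : Type*} [Fintype V] [DecidableEq V] {k : ℕ} (w : Fin (k + 1) → V) : ℕ :=
  Finset.univ.sup fun v => visits w v

/-!
A spectral gap makes the non-backtracking walk mix in `τ = O(log n)` steps: the numbers of
non-backtracking walks of length `k` between two vertices satisfy a second-order recurrence whose
characteristic roots have modulus at most some `ρ < q = d - 1` on the complement of the constants.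
The girth bounds the probability of a return at any given time by `q / (log n) ^ 2`, since
non-backtracking walks from the same vertex that are shorter than half the girth have different
ends.

*Upper bound.* The expected number of returns to a vertex within `τ` steps of a visit is
`O(1 / log n)`, and later returns have probability about `1 / n` per step. Discounting each step by
a factor `1 + θ` with `θ = log n / (n log log n)` brings the expected number of all returns to
`O(log log n / log n)`. Its `m`-th power bounds the discounted probability of `m` returns; for
`m ≈ (1 + δ) log n / log log n` it beats both the discount `(1 + θ) ^ n = n ^ o(1)` and the union
bound over the vertices.

*Lower bound.* Divide the walk into `j = ⌈(1 - δ) log n / log log n⌉` phases of `τ` mixing steps and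
`M ≈ δ n log log n / (64 log n)` further steps. By the second moment method, a phase visits with
high probability at least the proportion `M / (4 n) ≥ 1 / log n` of any set of at least
`(log n) ^ 4` vertices. Hence the set of the vertices visited in every phase so far shrinks at most
by a factor `log n` per phase and is still nonempty after `j` phases.
-/

namespace NonBacktracking

open Finset Filter Topology

/-! ### Non-backtracking walks as lists -/

section States

variable {V : Type*} {G : SimpleGraph V}

/-- The list `l` continues the state `p`, the pair of the last two vertices of a walk, to a
non-backtracking walk. The states `(v, v)`, at which no neighbour of `v` is excluded, stand for a
fresh start at `v`. -/
def IsContinuation (G : SimpleGraph V) : V × V → List V → Prop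
  | _, [] => True
  | p, w :: l => (G.Adj p.2 w ∧ w ≠ p.1) ∧ IsContinuation G (p.2, w) l

/-- The last two vertices of a walk after continuing the state `p` by the list `l`. -/
def finalState : V × V → List V → V × V
  | p, [] => p
  | p, w :: l => finalState (p.2, w) l

lemma finalState_append (p : V × V) (l l' : List V) :
    finalState p (l ++ l') = finalState (finalState p l) l' := by
  induction l generalizing p with
  | nil => rfl
  | cons w _ ih => exact ih (p.2, w)

lemma IsContinuation.adj_finalState {p : V × V} {l : List V} (h : IsContinuation G p l)
    (hp : G.Adj p.1 p.2) : G.Adj (finalState p l).1 (finalState p l).2 := by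
  induction l generalizing p with
  | nil => exact hp
  | cons w l ih => exact ih h.2 h.1.1

lemma IsContinuation.adj_finalState_of_ne_nil {p : V × V} {l : List V} (h : IsContinuation G p l)
    (hl : l ≠ []) : G.Adj (finalState p l).1 (finalState p l).2 := by
  cases l with
  | nil => exact absurd rfl hl
  | cons => exact h.2.adj_finalState h.1.1

lemma isContinuation_ofFn_tail_iff {k : ℕ} (u : V) (w : Fin (k + 1) → V) :
    IsContinuation G (u, w 0) (List.ofFn (Fin.tail w)) ↔
      (∀ s t : Fin (k + 1), (t : ℕ) = s + 1 → G.Adj (w s) (w t)) ∧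
      (∀ s t : Fin (k + 1), (t : ℕ) = s + 2 → w s ≠ w t) ∧
      ∀ t : Fin (k + 1), (t : ℕ) = 1 → u ≠ w t := by
  induction k generalizing u with
  | zero =>
    simp only [List.ofFn_zero, IsContinuation, true_iff]
    refine ⟨fun s t h => ?_, fun s t h => ?_, fun t h => ?_⟩ <;> lia
  | succ k ih =>
    have h0 : Fin.tail w 0 = w 1 := rfl
    rw [List.ofFn_succ]
    change (_ ∧ IsContinuation G (w 0, Fin.tail w 0) (List.ofFn (Fin.tail (Fin.tail w)))) ↔ _
    rw [ih, h0]
    simp only [Fin.forall_fin_succ (n := k + 1), Fin.tail]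
    constructor
    · rintro ⟨⟨h1, h2⟩, h3, h4, h5⟩
      refine ⟨⟨⟨by simp, fun t ht => ?_⟩,
          fun s => ⟨by simp, fun t ht => h3 s t (by simpa using ht)⟩⟩,
        ⟨⟨by simp, fun t ht => h5 t (by simpa using ht)⟩,
          fun s => ⟨by simp, fun t ht => h4 s t (by simp at ht; lia)⟩⟩,
        by simp, fun t ht => ?_⟩
      all_goals obtain rfl : t = 0 := Fin.ext (by simpa using ht)
      exacts [h1, h2.symm]
    · rintro ⟨⟨⟨-, h1⟩, h2⟩, ⟨⟨-, h3⟩, h4⟩, -, h5⟩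
      exact ⟨⟨h1 0 (by simp), (h5 0 (by simp)).symm⟩,
        fun s t ht => (h2 s).2 t (by simpa using ht),
        fun s t ht => (h4 s).2 t (by simp; lia),
        fun t ht => h3 t (by simpa using ht)⟩

lemma isNonBacktrackingWalk_iff {k : ℕ} (w₀ : V) (w : Fin (k + 1) → V) :
    IsNonBacktrackingWalk G w₀ k w ↔
      w 0 = w₀ ∧ IsContinuation G (w₀, w₀) (List.ofFn (Fin.tail w)) := by
  rw [IsNonBacktrackingWalk]
  refine and_congr_right fun h => ?_
  subst h
  rw [isContinuation_ofFn_tail_iff]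
  exact ⟨fun h => ⟨h.1, h.2, fun t ht => (h.1 0 t (by simpa using ht)).ne⟩,
    fun h => ⟨h.1, h.2.1⟩⟩

lemma count_ofFn [DecidableEq V] {k : ℕ} (f : Fin k → V) (v : V) :
    (List.ofFn f).count v = #{i | f i = v} := by
  rw [card_filter]
  induction k with
  | zero => simp
  | succ k ih => rw [Fin.sum_univ_succ, List.ofFn_succ, List.count_cons, ih, add_comm]; simp

lemma visits_eq_count [DecidableEq V] {k : ℕ} (w : Fin (k + 1) → V) (v : V) :
    visits w v = (List.ofFn w).count v :=
  (count_ofFn w v).symm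

end States

/-! ### Girth -/

section Girth

variable {V : Type*} {G : SimpleGraph V}

lemma isAcyclic_of_edges_mem_list {H : SimpleGraph V} (hHG : H ≤ G) {L : List (Sym2 V)}
    (hH : ∀ e ∈ H.edgeSet, e ∈ L) (hL : L.length < G.girth) : H.IsAcyclic := by
  intro a c hc
  have h1 : G.girth ≤ c.length := by
    simpa using SimpleGraph.girth_le_length (hc.mapLe hHG)
  have h2 : c.edges.length ≤ L.length :=
    (hc.edges_nodup.subperm fun e he => hH e (c.edges_subset_edgeSet he)).length_le
  rw [SimpleGraph.Walk.length_edges] at h2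
  lia

lemma walk_unique_of_length_lt_girth {u v : V} {p q : G.Walk u v}
    (hp : p.edges.IsChain (· ≠ ·)) (hq : q.edges.IsChain (· ≠ ·))
    (h : p.length + q.length < G.girth) : p = q := by
  set H : SimpleGraph V := SimpleGraph.fromEdgeSet {e | e ∈ p.edges ++ q.edges} with hH
  have hHG : H ≤ G := fun a b hab => by
    rw [hH, SimpleGraph.fromEdgeSet_adj] at hab
    exact (List.mem_append.1 hab.1).elim p.adj_of_mem_edges q.adj_of_mem_edges
  have hacyc : H.IsAcyclic := by
    refine isAcyclic_of_edges_mem_list hHG (L := p.edges ++ q.edges) (fun e he => ?_) (by simpa)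
    rw [hH, SimpleGraph.edgeSet_fromEdgeSet] at he
    exact he.1
  have hmem {r : G.Walk u v} (hr : ∀ e ∈ r.edges, e ∈ p.edges ++ q.edges) :
      ∀ e ∈ r.edges, e ∈ H.edgeSet := fun e he => by
    rw [hH, SimpleGraph.edgeSet_fromEdgeSet]
    exact ⟨hr e he, G.not_isDiag_of_mem_edgeSet (r.edges_subset_edgeSet he)⟩
  have hpH := hmem (r := p) fun e he => List.mem_append_left _ he
  have hqH := hmem (r := q) fun e he => List.mem_append_right _ he
  have hp' : (p.transfer H hpH).IsPath := by
    rwa [hacyc.isPath_iff_isChain, SimpleGraph.Walk.edges_transfer]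
  have hq' : (q.transfer H hqH).IsPath := by
    rwa [hacyc.isPath_iff_isChain, SimpleGraph.Walk.edges_transfer]
  have hsupp := congrArg (fun P : H.Path u v => P.1.support)
    ((hacyc.subsingleton_path u v).elim ⟨_, hp'⟩ ⟨_, hq'⟩)
  simp only [SimpleGraph.Walk.support_transfer] at hsupp
  exact SimpleGraph.Walk.ext_support hsupp

lemma IsContinuation.exists_walk {p : V × V} {l : List V} (h : IsContinuation G p l) {v : V}
    (hv : (finalState p l).2 = v) :
    ∃ W : G.Walk p.2 v, W.support = p.2 :: l ∧ (s(p.1, p.2) :: W.edges).IsChain (· ≠ ·) := by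
  induction l generalizing p with
  | nil => exact hv ▸ ⟨.nil, rfl, List.isChain_singleton _⟩
  | cons w l ih =>
    obtain ⟨W, hW, hc⟩ := ih h.2 hv
    obtain ⟨hadj, hne⟩ := h.1
    refine ⟨.cons hadj W, by simp [hW], ?_⟩
    rw [SimpleGraph.Walk.edges_cons, List.isChain_cons_cons]
    refine ⟨fun he => ?_, hc⟩
    rcases Sym2.eq_iff.1 he with ⟨-, h3⟩ | ⟨h3, -⟩
    · exact hadj.ne h3
    · exact hne h3.symm

lemma IsContinuation.eq_of_length_lt_girth {p : V × V} {l l' : List V}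
    (h : IsContinuation G p l) (h' : IsContinuation G p l')
    (hend : (finalState p l).2 = (finalState p l').2) (hlen : l.length + l'.length < G.girth) :
    l = l' := by
  obtain ⟨W, hW, hc⟩ := h.exists_walk hend
  obtain ⟨W', hW', hc'⟩ := h'.exists_walk rfl
  have length_eq {U : G.Walk p.2 (finalState p l').2} {m : List V} (hU : U.support = p.2 :: m) :
      U.length = m.length := by
    simpa using congrArg List.length hU
  obtain rfl : W = W' := walk_unique_of_length_lt_girth hc.tail hc'.tail
    (by rwa [length_eq hW, length_eq hW'])
  exact (List.cons.inj (hW.symm.trans hW')).2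

end Girth

/-! ### Expectations over the non-backtracking walk -/

section Expectation

variable {V : Type*} [Fintype V] [DecidableEq V] (G : SimpleGraph V) [DecidableRel G.Adj]

/-- The vertices to which a non-backtracking walk may proceed from the state `p`. -/
def nextVertices (p : V × V) : Finset V := (G.neighborFinset p.2).erase p.1

/-- The sum of `F` over all non-backtracking continuations of length `k` from the state `p`. -/
def walkSum : ℕ → V × V → (List V → ℝ) → ℝ
  | 0, _, F => F []
  | k + 1, p, F => ∑ w ∈ nextVertices G p, walkSum k (p.2, w) fun l => F (w :: l)

/-- The expectation of `F` over a non-backtracking random walk of length `k` from the state `p`;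
`F` is applied to the list of the vertices that follow `p.2`. The walk is generated as a Markov
chain on states, which in a regular graph gives the uniform distribution on continuations. -/
noncomputable def walkExp : ℕ → V × V → (List V → ℝ) → ℝ
  | 0, _, F => F []
  | k + 1, p, F =>
    (∑ w ∈ nextVertices G p, walkExp k (p.2, w) fun l => F (w :: l)) / #(nextVertices G p)

open Classical in
/-- The probability that a non-backtracking random walk of length `k` from the state `p` continues
it by a list with the property `P`. -/
noncomputable def walkProb (k : ℕ) (p : V × V) (P : List V → Prop) : ℝ :=
  walkExp G k p fun l => if P l then 1 else 0

variable {G}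

lemma mem_nextVertices {p : V × V} {w : V} : w ∈ nextVertices G p ↔ G.Adj p.2 w ∧ w ≠ p.1 := by
  simp [nextVertices, and_comm]

lemma nextVertices_self (v : V) : nextVertices G (v, v) = G.neighborFinset v :=
  erase_eq_of_notMem (by simp)

lemma card_nextVertices_of_adj {p : V × V} (hp : G.Adj p.1 p.2) :
    #(nextVertices G p) = G.degree p.2 - 1 := by
  rw [nextVertices, card_erase_of_mem (by simpa using hp.symm), G.card_neighborFinset_eq_degree]

lemma card_nextVertices_pos (hG : ∀ v, 2 ≤ G.degree v) (p : V × V) : 0 < #(nextVertices G p) := by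
  have h : #(G.neighborFinset p.2) - 1 ≤ #(nextVertices G p) := pred_card_le_card_erase
  rw [G.card_neighborFinset_eq_degree] at h
  have := hG p.2
  lia

lemma walkExp_mono {k : ℕ} {p : V × V} {F F' : List V → ℝ}
    (h : ∀ l, l.length = k → IsContinuation G p l → F l ≤ F' l) :
    walkExp G k p F ≤ walkExp G k p F' := by
  induction k generalizing p F F' with
  | zero => exact h [] rfl trivial
  | succ k ih =>
    exact div_le_div_of_nonneg_right (sum_le_sum fun w hw => ih fun l hl hc =>
      h _ (by simp [hl]) ⟨mem_nextVertices.1 hw, hc⟩) (Nat.cast_nonneg _)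

lemma walkExp_congr {k : ℕ} {p : V × V} {F F' : List V → ℝ}
    (h : ∀ l, l.length = k → IsContinuation G p l → F l = F' l) :
    walkExp G k p F = walkExp G k p F' :=
  le_antisymm (walkExp_mono fun l hl hc => (h l hl hc).le)
    (walkExp_mono fun l hl hc => (h l hl hc).ge)

lemma walkExp_add (k : ℕ) (p : V × V) (F F' : List V → ℝ) :
    walkExp G k p (fun l => F l + F' l) = walkExp G k p F + walkExp G k p F' := by
  induction k generalizing p F F' with
  | zero => rfl
  | succ k ih => simp only [walkExp, ih, sum_add_distrib, add_div]

lemma walkExp_const_mul (k : ℕ) (p : V × V) (c : ℝ) (F : List V → ℝ) :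
    walkExp G k p (fun l => c * F l) = c * walkExp G k p F := by
  induction k generalizing p F with
  | zero => rfl
  | succ k ih => simp only [walkExp, ih, ← mul_sum, mul_div_assoc]

lemma walkExp_zero (k : ℕ) (p : V × V) : walkExp G k p (fun _ => 0) = 0 := by
  simpa using walkExp_const_mul (G := G) k p 0 fun _ => 0

lemma walkExp_sum {ι : Type*} (s : Finset ι) (k : ℕ) (p : V × V) (F : ι → List V → ℝ) :
    walkExp G k p (fun l => ∑ i ∈ s, F i l) = ∑ i ∈ s, walkExp G k p (F i) := by
  classical
  induction s using Finset.induction_on with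
  | empty => simpa using walkExp_zero k p
  | insert i s hi ih => simp only [sum_insert hi, walkExp_add, ih]

lemma walkExp_const (hG : ∀ v, 2 ≤ G.degree v) (k : ℕ) (p : V × V) (c : ℝ) :
    walkExp G k p (fun _ => c) = c := by
  induction k generalizing p with
  | zero => rfl
  | succ k ih =>
    have := card_nextVertices_pos hG p
    simp only [walkExp, ih, sum_const, nsmul_eq_mul]
    field_simp

lemma walkExp_append (s t : ℕ) (p : V × V) (F : List V → ℝ) :
    walkExp G (s + t) p F =
      walkExp G s p fun l => walkExp G t (finalState p l) fun l' => F (l ++ l') := by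
  induction s generalizing p F with
  | zero => simp [walkExp, finalState]
  | succ s ih =>
    rw [Nat.succ_add]
    simp only [walkExp, ih, finalState, List.cons_append]

end Expectation

section Probability

variable {V : Type*} [Fintype V] [DecidableEq V] {G : SimpleGraph V} [DecidableRel G.Adj]

lemma walkProb_mono {k : ℕ} {p : V × V} {P Q : List V → Prop}
    (h : ∀ l, l.length = k → IsContinuation G p l → P l → Q l) :
    walkProb G k p P ≤ walkProb G k p Q :=
  walkExp_mono fun l hl hc => by
    have := h l hl hc
    split_ifs <;> simp_all

lemma walkProb_le_walkExp {k : ℕ} {p : V × V} {P : List V → Prop} {F : List V → ℝ}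
    (hF : ∀ l, 0 ≤ F l) (h : ∀ l, l.length = k → P l → 1 ≤ F l) :
    walkProb G k p P ≤ walkExp G k p F :=
  walkExp_mono fun l hl _ => by
    split_ifs with hP
    exacts [h l hl hP, hF l]

lemma walkProb_le_one (hG : ∀ v, 2 ≤ G.degree v) (k : ℕ) (p : V × V) (P : List V → Prop) :
    walkProb G k p P ≤ 1 := by
  rw [← walkExp_const hG k p 1]
  exact walkExp_mono fun l _ _ => by split_ifs <;> simp

lemma walkProb_add_walkProb_not (hG : ∀ v, 2 ≤ G.degree v) (k : ℕ) (p : V × V)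
    (P : List V → Prop) : walkProb G k p P + walkProb G k p (fun l => ¬P l) = 1 := by
  rw [walkProb, walkProb, ← walkExp_add]
  refine (walkExp_congr fun l _ _ => ?_).trans (walkExp_const hG k p 1)
  by_cases h : P l <;> simp [h]

lemma walkProb_or_le (k : ℕ) (p : V × V) (P Q : List V → Prop) :
    walkProb G k p (fun l => P l ∨ Q l) ≤ walkProb G k p P + walkProb G k p Q := by
  rw [walkProb, walkProb, walkProb, ← walkExp_add]
  refine walkExp_mono fun l _ _ => ?_
  by_cases hP : P l <;> by_cases hQ : Q l <;> simp [hP, hQ]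

lemma walkProb_append (s t : ℕ) (p : V × V) (P : List V → Prop) :
    walkProb G (s + t) p P =
      walkExp G s p fun l => walkProb G t (finalState p l) fun l' => P (l ++ l') :=
  walkExp_append s t p _

lemma walkProb_append_le (hG : ∀ v, 2 ≤ G.degree v) {s t : ℕ} {p : V × V} {P B : List V → Prop}
    {c : ℝ} (hc : 0 ≤ c) (h : ∀ l, l.length = s → IsContinuation G p l → ¬B l →
      walkProb G t (finalState p l) (fun l' => P (l ++ l')) ≤ c) :
    walkProb G (s + t) p P ≤ walkProb G s p B + c := by
  rw [walkProb_append, walkProb, ← walkExp_const hG s p c, ← walkExp_add]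
  refine walkExp_mono fun l hl hcont => ?_
  split_ifs with hB
  · linarith [walkProb_le_one hG t (finalState p l) fun l' => P (l ++ l')]
  · simpa using h l hl hcont hB

end Probability

/-! ### The uniform distribution in a regular graph -/

section Uniform

variable {V : Type*} [Fintype V] [DecidableEq V] {G : SimpleGraph V} [DecidableRel G.Adj]
  {q : ℕ}

lemma walkSum_eq_of_adj (hG : G.IsRegularOfDegree (q + 1)) (k : ℕ) {p : V × V}
    (hp : G.Adj p.1 p.2) (F : List V → ℝ) : walkSum G k p F = q ^ k * walkExp G k p F := by
  induction k generalizing p F with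
  | zero => simp [walkSum, walkExp]
  | succ k ih =>
    have hsum : walkSum G (k + 1) p F = ∑ w ∈ nextVertices G p,
        q ^ k * walkExp G k (p.2, w) fun l => F (w :: l) :=
      sum_congr rfl fun w hw => ih (mem_nextVertices.1 hw).1 _
    have hcard : #(nextVertices G p) = q := by simp [card_nextVertices_of_adj hp, hG p.2]
    rw [hsum, walkExp, hcard, ← mul_sum]
    rcases Nat.eq_zero_or_pos q with rfl | hq
    · rw [card_eq_zero.1 hcard]; simp
    · field_simp
      ring

lemma walkSum_succ_self (hG : G.IsRegularOfDegree (q + 1)) (k : ℕ) (v : V) (F : List V → ℝ) :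
    walkSum G (k + 1) (v, v) F = (q + 1) * q ^ k * walkExp G (k + 1) (v, v) F := by
  have hsum : walkSum G (k + 1) (v, v) F = ∑ w ∈ nextVertices G (v, v),
      q ^ k * walkExp G k (v, w) fun l => F (w :: l) :=
    sum_congr rfl fun w hw => walkSum_eq_of_adj hG k (mem_nextVertices.1 hw).1 _
  have hcard : (#(nextVertices G (v, v)) : ℝ) = q + 1 := by
    simp [nextVertices_self, hG v]
  rw [hsum, walkExp, hcard, ← mul_sum]
  field_simp

open Classical in
lemma walkSum_eq_sum (k : ℕ) (p : V × V) (F : List V → ℝ) :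
    walkSum G k p F =
      ∑ f : Fin k → V with IsContinuation G p (List.ofFn f), F (List.ofFn f) := by
  rw [sum_filter]
  induction k generalizing p F with
  | zero => simp [walkSum, IsContinuation]
  | succ k ih =>
    rw [← (Fin.consEquiv fun _ : Fin (k + 1) => V).sum_comp, Fintype.sum_prod_type]
    simp only [walkSum, ih, Fin.consEquiv, Equiv.coe_fn_mk, List.ofFn_cons, IsContinuation,
      ← mem_nextVertices, ite_and]
    simp

lemma sum_nonBacktrackingWalks (k : ℕ) (w₀ : V) (F : List V → ℝ) :
    ∑ w ∈ nonBacktrackingWalks G w₀ k, F (List.ofFn w) =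
      walkSum G k (w₀, w₀) fun l => F (w₀ :: l) := by
  classical
  rw [walkSum_eq_sum, nonBacktrackingWalks, sum_filter, sum_filter,
    ← (Fin.consEquiv fun _ : Fin (k + 1) => V).sum_comp, Fintype.sum_prod_type, sum_eq_single w₀]
  · simp [Fin.consEquiv, isNonBacktrackingWalk_iff]
  · intro w _ hw
    simp [Fin.consEquiv, isNonBacktrackingWalk_iff, hw]
  · simp

lemma nonBacktrackingProb_eq_walkProb (hG : G.IsRegularOfDegree (q + 1)) (hq : 1 ≤ q) (k : ℕ)
    (w₀ : V) (P : List V → Prop) :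
    nonBacktrackingProb G w₀ (k + 1) (fun w => P (List.ofFn w)) =
      walkProb G (k + 1) (w₀, w₀) fun l => P (w₀ :: l) := by
  classical
  have hnum : (#{w ∈ nonBacktrackingWalks G w₀ (k + 1) | P (List.ofFn w)} : ℝ) =
      (q + 1) * q ^ k * walkProb G (k + 1) (w₀, w₀) fun l => P (w₀ :: l) := by
    rw [walkProb, ← walkSum_succ_self hG, ← sum_boole]
    convert sum_nonBacktrackingWalks (k + 1) w₀ fun l => if P l then (1 : ℝ) else 0
  have hden : (#(nonBacktrackingWalks G w₀ (k + 1)) : ℝ) = (q + 1) * q ^ k := by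
    have h := sum_nonBacktrackingWalks (G := G) (k + 1) w₀ fun _ => 1
    rwa [walkSum_succ_self hG, walkExp_const fun v => by rw [hG v]; lia, sum_const,
      nsmul_eq_mul, mul_one, mul_one] at h
  rw [nonBacktrackingProb, hden, div_eq_iff (by positivity), mul_comm (walkProb _ _ _ _), ← hnum]

end Uniform

/-! ### The recurrence of the non-backtracking walk matrices -/

section Recurrence

/-- The recurrence satisfied by `f k = A k x`, where `A k` counts the non-backtracking walks of
length `k` in a `(q + 1)`-regular graph with adjacency operator `T`. -/
def IsWalkRecurrence {E : Type*} [AddCommGroup E] [Module ℝ E] (T : E → E) (q : ℝ) (f : ℕ → E) :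
    Prop :=
  f 1 = T (f 0) ∧ f 2 = T (f 1) - (q + 1) • f 0 ∧ ∀ k, f (k + 3) = T (f (k + 2)) - q • f (k + 1)

lemma IsWalkRecurrence.map {E F : Type*} [AddCommGroup E] [Module ℝ E] [AddCommGroup F] [Module ℝ F]
    {T : E → E} {S : F → F} {q : ℝ} {f : ℕ → E} (hf : IsWalkRecurrence T q f) (φ : E →ₗ[ℝ] F)
    (hφ : ∀ x, φ (T x) = S (φ x)) : IsWalkRecurrence S q fun k => φ (f k) :=
  ⟨by simp only [hf.1, hφ], by simp only [hf.2.1, map_sub, hφ, map_smul],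
    fun k => by simp only [hf.2.2 k, map_sub, hφ, map_smul]⟩

lemma IsWalkRecurrence.eq_zero {E : Type*} [AddCommGroup E] [Module ℝ E] {T : E → E} {q : ℝ}
    {f : ℕ → E} (hf : IsWalkRecurrence T q f) (hT : T 0 = 0) (h0 : f 0 = 0) (k : ℕ) : f k = 0 := by
  induction k using Nat.strong_induction_on with
  | _ k ih =>
    match k with
    | 0 => exact h0
    | 1 => rw [hf.1, h0, hT]
    | 2 => rw [hf.2.1, ih 1 (by lia), h0, hT, smul_zero, sub_zero]
    | k + 3 => rw [hf.2.2, ih (k + 2) (by lia), ih (k + 1) (by lia), hT, smul_zero, sub_zero]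

lemma abs_le_of_sq_add_eq {q ρ μ x : ℝ} (hq : 0 < q) (hρ : 0 < ρ) (hρq : q ≤ ρ ^ 2)
    (hμ : |μ| ≤ ρ + q / ρ) (hx : x ^ 2 + q = μ * x) : |x| ≤ ρ := by
  by_contra! hlt
  have hμ' : |μ| * ρ ≤ ρ ^ 2 + q := by
    calc |μ| * ρ ≤ (ρ + q / ρ) * ρ := by gcongr
      _ = ρ ^ 2 + q := by field_simp
  have hx' : |x| ^ 2 + q = |μ| * |x| := by
    rw [sq_abs, hx, ← abs_mul, ← hx, abs_of_nonneg (by positivity)]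
  have hle : (|x| - ρ) * (|x| * ρ - q) ≤ 0 := by
    linear_combination |x| * hμ' + ρ * hx'
  exact hle.not_gt (mul_pos (sub_pos.2 hlt) (by nlinarith))

lemma norm_le_of_quadratic {q ρ μ : ℝ} (hq : 0 < q) (hρ : 0 < ρ) (hρq : q ≤ ρ ^ 2)
    (hμ : |μ| ≤ ρ + q / ρ) {z : ℂ} (hz : z ^ 2 - μ * z + q = 0) : ‖z‖ ≤ ρ := by
  have hre := congrArg Complex.re hz
  have him := congrArg Complex.im hz
  simp only [pow_two, Complex.add_re, Complex.sub_re, Complex.mul_re, Complex.ofReal_re,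
    Complex.ofReal_im, Complex.zero_re] at hre
  simp only [pow_two, Complex.add_im, Complex.sub_im, Complex.mul_im, Complex.ofReal_re,
    Complex.ofReal_im, Complex.zero_im] at him
  by_cases h0 : z.im = 0
  · have hz' : z = (z.re : ℂ) := Complex.ext rfl (by simpa using h0)
    rw [hz', Complex.norm_real]
    refine abs_le_of_sq_add_eq hq hρ hρq hμ ?_
    rw [h0] at hre
    linarith
  · have hμz : 2 * z.re - μ = 0 :=
      (mul_eq_zero.1 (by linarith : z.im * (2 * z.re - μ) = 0)).resolve_left h0
    have hnorm : ‖z‖ ^ 2 = q := by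
      rw [Complex.sq_norm, Complex.normSq_apply, ← sub_eq_zero]
      linear_combination z.re * hμz - hre
    exact (pow_le_pow_iff_left₀ (norm_nonneg z) hρ.le two_ne_zero).1 (hnorm.trans_le hρq)

variable {q ρ : ℝ}

/-- With `z₁ + z₂ = μ` and `z₁ z₂ = q`, the sequence `x (k + 1) - z₁ * x k` is geometric with ratio
`z₂` from `k = 1` on. -/
lemma IsWalkRecurrence.norm_succ_sub_le {μ : ℝ} {x : ℕ → ℝ} (hx : IsWalkRecurrence (μ * ·) q x)
    (hρ : 1 ≤ ρ) {z₁ z₂ : ℂ} (hsum : (μ : ℂ) = z₁ + z₂) (hprod : (q : ℂ) = z₁ * z₂)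
    (hz₂ : ‖z₂‖ ≤ ρ) (k : ℕ) : ‖(x (k + 1) : ℂ) - z₁ * x k‖ ≤ 2 * ρ ^ (k + 1) * |x 0| := by
  have hx0 : ‖(x 0 : ℂ)‖ = |x 0| := by rw [Complex.norm_real, Real.norm_eq_abs]
  have h1 : (x 1 : ℂ) - z₁ * x 0 = z₂ * x 0 := by
    rw [hx.1]; push_cast; rw [hsum]; ring
  induction k with
  | zero =>
    rw [zero_add, h1, norm_mul, hx0, pow_one]
    gcongr
    linarith
  | succ k ih =>
    match k with
    | 0 =>
      have h2 : (x 2 : ℂ) - z₁ * x 1 = (z₂ ^ 2 - 1) * x 0 := by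
        rw [hx.2.1, smul_eq_mul]; push_cast; linear_combination (x 1 : ℂ) * hsum + z₂ * h1 -
          (x 0 : ℂ) * hprod
      have hz₂' : ‖z₂ ^ 2 - 1‖ ≤ 2 * ρ ^ 2 := by
        calc ‖z₂ ^ 2 - 1‖ ≤ ‖z₂‖ ^ 2 + 1 :=
              (norm_sub_le _ _).trans_eq (by rw [norm_pow, norm_one])
          _ ≤ ρ ^ 2 + ρ ^ 2 := by gcongr; exact one_le_pow₀ hρ
          _ = 2 * ρ ^ 2 := by ring
      rw [h2, norm_mul, hx0]
      gcongr
    | k + 1 =>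
      have h3 : (x (k + 3) : ℂ) - z₁ * x (k + 2) = z₂ * (x (k + 2) - z₁ * x (k + 1)) := by
        rw [hx.2.2, smul_eq_mul]; push_cast; rw [hsum, hprod]; ring
      calc ‖(x (k + 3) : ℂ) - z₁ * x (k + 2)‖
          ≤ ρ * (2 * ρ ^ (k + 2) * |x 0|) := by rw [h3, norm_mul]; gcongr
        _ = 2 * ρ ^ (k + 3) * |x 0| := by ring

lemma IsWalkRecurrence.abs_le {μ : ℝ} {x : ℕ → ℝ} (hx : IsWalkRecurrence (μ * ·) q x) (hq : 1 ≤ q)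
    (hρ : 0 < ρ) (hρq : q ≤ ρ ^ 2) (hμ : |μ| ≤ ρ + q / ρ) (k : ℕ) :
    |x k| ≤ (2 * k + 1) * ρ ^ k * |x 0| := by
  obtain ⟨s, hs⟩ := IsAlgClosed.exists_eq_mul_self ((μ : ℂ) ^ 2 - 4 * q)
  obtain ⟨z₁, z₂, hsum, hprod⟩ : ∃ z₁ z₂ : ℂ, (μ : ℂ) = z₁ + z₂ ∧ (q : ℂ) = z₁ * z₂ :=
    ⟨(μ + s) / 2, (μ - s) / 2, by ring, by linear_combination (-1 / 4 : ℂ) * hs⟩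
  have hz {z : ℂ} (hz : z = z₁ ∨ z = z₂) : ‖z‖ ≤ ρ := by
    refine norm_le_of_quadratic (by linarith) hρ hρq hμ ?_
    rw [hsum, hprod]
    rcases hz with rfl | rfl <;> ring
  have hρ1 : 1 ≤ ρ := by nlinarith
  induction k with
  | zero => simp
  | succ k ih =>
    have hstep := hx.norm_succ_sub_le hρ1 hsum hprod (hz (.inr rfl)) k
    calc |x (k + 1)| = ‖z₁ * (x k : ℂ) + (x (k + 1) - z₁ * x k)‖ := by
          rw [add_sub_cancel, Complex.norm_real, Real.norm_eq_abs]
      _ ≤ ‖z₁‖ * |x k| + ‖(x (k + 1) : ℂ) - z₁ * x k‖ := by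
          refine (norm_add_le _ _).trans_eq ?_
          rw [norm_mul, Complex.norm_real, Real.norm_eq_abs]
      _ ≤ ρ * ((2 * k + 1) * ρ ^ k * |x 0|) + 2 * ρ ^ (k + 1) * |x 0| := by
          gcongr
          exact hz (.inl rfl)
      _ = (2 * (k + 1 : ℕ) + 1) * ρ ^ (k + 1) * |x 0| := by push_cast; ring

variable {E ι : Type*} [NormedAddCommGroup E] [InnerProductSpace ℝ E] [Fintype ι]

lemma IsWalkRecurrence.norm_le (b : OrthonormalBasis ι ℝ E) {T : E → E} {μ : ι → ℝ}
    (hT : ∀ i x, inner ℝ (b i) (T x) = μ i * inner ℝ (b i) x) {f : ℕ → E}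
    (hf : IsWalkRecurrence T q f) (hq : 1 ≤ q) (hρ : 0 < ρ) (hρq : q ≤ ρ ^ 2)
    (hμ : ∀ i, inner ℝ (b i) (f 0) = 0 ∨ |μ i| ≤ ρ + q / ρ) (k : ℕ) :
    ‖f k‖ ≤ (2 * k + 1) * ρ ^ k * ‖f 0‖ := by
  have hcoeff (i : ι) : IsWalkRecurrence (μ i * ·) q fun k => inner ℝ (b i) (f k) :=
    hf.map (innerₛₗ ℝ (b i)) (hT i)
  have hle (i : ι) : |inner ℝ (b i) (f k)| ≤ (2 * k + 1) * ρ ^ k * |inner ℝ (b i) (f 0)| := by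
    rcases hμ i with h0 | hμi
    · rw [(hcoeff i).eq_zero (mul_zero _) h0, abs_zero]
      positivity
    · exact (hcoeff i).abs_le hq hρ hρq hμi k
  have hsq : ‖f k‖ ^ 2 ≤ ((2 * k + 1) * ρ ^ k * ‖f 0‖) ^ 2 := by
    rw [mul_pow, ← b.sum_sq_norm_inner_right, ← b.sum_sq_norm_inner_right, mul_sum]
    refine sum_le_sum fun i _ => ?_
    rw [← mul_pow]
    exact pow_le_pow_left₀ (norm_nonneg _) (hle i) 2
  exact (pow_le_pow_iff_left₀ (norm_nonneg _) (by positivity) two_ne_zero).1 hsq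

lemma inner_eq_zero_of_orthogonal (b : OrthonormalBasis ι ℝ E) {i₀ : ι} {u f : E} (hu : u ≠ 0)
    (hub : ∀ i ≠ i₀, inner ℝ u (b i) = 0) (huf : inner ℝ u f = 0) : inner ℝ (b i₀) f = 0 := by
  have expand (x : E) : inner ℝ u x = inner ℝ u (b i₀) * inner ℝ (b i₀) x := by
    rw [← b.sum_inner_mul_inner u x]
    exact sum_eq_single i₀ (fun i _ hi => by rw [hub i hi, zero_mul]) (by simp)
  have hui₀ : inner ℝ u (b i₀) ≠ 0 := fun h =>
    hu (inner_self_eq_zero.1 (by rw [expand u, h, zero_mul]))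
  exact (mul_eq_zero.1 ((expand f).symm.trans huf)).resolve_left hui₀

end Recurrence

/-! ### Spectral gap and mixing -/

section EndSum

variable {V : Type*} [Fintype V] [DecidableEq V] (G : SimpleGraph V) [DecidableRel G.Adj]

/-- The sum of `f` over the last vertices of all continuations of length `t` from `p`. -/
def endSum (f : V → ℝ) (t : ℕ) (p : V × V) : ℝ :=
  walkSum G t p fun l => f (finalState p l).2

variable {G}

lemma endSum_succ_self (f : V → ℝ) (t : ℕ) (v : V) :
    endSum G f (t + 1) (v, v) = ∑ w ∈ G.neighborFinset v, endSum G f t (v, w) := by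
  rw [← nextVertices_self]
  rfl

lemma endSum_succ_of_adj (f : V → ℝ) (t : ℕ) {u v : V} (h : G.Adj u v) :
    endSum G f (t + 1) (u, v) = endSum G f (t + 1) (v, v) - endSum G f t (v, u) := by
  rw [endSum_succ_self, eq_sub_iff_add_eq]
  exact sum_erase_add (G.neighborFinset v) _ (by simpa using h.symm)

lemma endSum_add_two_self (f : V → ℝ) (t : ℕ) (v : V) :
    endSum G f (t + 2) (v, v) = ∑ w ∈ G.neighborFinset v, endSum G f (t + 1) (w, w) -
      ∑ w ∈ G.neighborFinset v, endSum G f t (w, v) := by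
  rw [endSum_succ_self, ← sum_sub_distrib]
  exact sum_congr rfl fun w hw => endSum_succ_of_adj f t (by simpa using hw)

lemma sum_endSum_neighborFinset {q : ℕ} (hG : G.IsRegularOfDegree (q + 1)) (f : V → ℝ) (t : ℕ)
    (v : V) : ∑ w ∈ G.neighborFinset v, endSum G f (t + 1) (w, v) =
      q * endSum G f (t + 1) (v, v) := by
  have hadj : ∀ w ∈ G.neighborFinset v, endSum G f (t + 1) (w, v) =
      endSum G f (t + 1) (v, v) - endSum G f t (v, w) := fun w hw =>
    endSum_succ_of_adj f t (by simpa using ((G.mem_neighborFinset v w).1 hw).symm)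
  rw [sum_congr rfl hadj, sum_sub_distrib, sum_const, G.card_neighborFinset_eq_degree, hG v,
    ← endSum_succ_self, nsmul_eq_mul]
  push_cast
  ring

lemma isWalkRecurrence_endSum {q : ℕ} (hG : G.IsRegularOfDegree (q + 1)) (f : V → ℝ) :
    IsWalkRecurrence (G.adjMatrix ℝ).toEuclideanLin q
      fun t => WithLp.toLp 2 fun v => endSum G f t (v, v) := by
  refine ⟨?_, ?_, fun k => ?_⟩ <;> ext v <;>
    simp only [Matrix.ofLp_toLpLin, Matrix.toLin'_apply, SimpleGraph.adjMatrix_mulVec_apply,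
      PiLp.sub_apply, PiLp.smul_apply, smul_eq_mul]
  · exact endSum_succ_self f 0 v
  · have h0 : ∀ w ∈ G.neighborFinset v, endSum G f 0 (w, v) = endSum G f 0 (v, v) :=
      fun _ _ => rfl
    rw [endSum_add_two_self, sum_congr rfl h0, sum_const, G.card_neighborFinset_eq_degree, hG v,
      nsmul_eq_mul]
    push_cast
    rfl
  · rw [endSum_add_two_self, sum_endSum_neighborFinset hG]

end EndSum

section Spectral

variable {V : Type*} [Fintype V] [DecidableEq V] {G : SimpleGraph V} [DecidableRel G.Adj]

lemma inner_eigenvectorBasis_adjMatrix (i : V) (x : EuclideanSpace ℝ V) :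
    inner ℝ ((adjMatrix_isHermitian G).eigenvectorBasis i) ((G.adjMatrix ℝ).toEuclideanLin x) =
      (adjMatrix_isHermitian G).eigenvalues i *
        inner ℝ ((adjMatrix_isHermitian G).eigenvectorBasis i) x := by
  have hsymm := Matrix.isSymmetric_toEuclideanLin_iff.2 (adjMatrix_isHermitian G)
  have heigen : (G.adjMatrix ℝ).toEuclideanLin ((adjMatrix_isHermitian G).eigenvectorBasis i) =
      (adjMatrix_isHermitian G).eigenvalues i • (adjMatrix_isHermitian G).eigenvectorBasis i := by
    ext v
    exact congrFun ((adjMatrix_isHermitian G).mulVec_eigenvectorBasis i) v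
  rw [← hsymm, heigen, real_inner_smul_left]

variable {n d : ℕ} {lam : ℝ}

lemma exists_abs_eigenvalues_le (hG : IsNDLGraph G n d lam) :
    ∃ i₀, ∀ i ≠ i₀, |(adjMatrix_isHermitian G).eigenvalues i| ≤ lam := by
  obtain ⟨-, -, -, ⟨j, -, -⟩, hlam⟩ := hG
  let e : Fin (Fintype.card V) ≃ V := Fintype.equivOfCardEq (Fintype.card_fin _)
  refine ⟨e ⟨0, j.pos⟩, fun i hi => hlam ⟨e.symm i, Nat.pos_of_ne_zero fun h0 => hi ?_, rfl⟩⟩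
  rw [← e.symm_apply_eq]
  exact Fin.ext h0

lemma inner_eq_zero_or_abs_eigenvalues_le (hG : IsNDLGraph G n d lam) {f : V → ℝ}
    (hf : ∑ v, f v = 0) (i : V) :
    inner ℝ ((adjMatrix_isHermitian G).eigenvectorBasis i) (WithLp.toLp 2 f) = 0 ∨
      |(adjMatrix_isHermitian G).eigenvalues i| ≤ lam := by
  obtain ⟨i₀, hi₀⟩ := exists_abs_eigenvalues_le hG
  rcases ne_or_eq i i₀ with hi | rfl
  · exact .inr (hi₀ i hi)
  set u : EuclideanSpace ℝ V := WithLp.toLp 2 fun _ => 1 with hu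
  have hAu : (G.adjMatrix ℝ).toEuclideanLin u = (d : ℝ) • u := by
    ext v
    simp [hu, SimpleGraph.adjMatrix_mulVec_apply, hG.2.1 v]
  refine .inl (inner_eq_zero_of_orthogonal _ (u := u) (fun h => ?_) (fun j hj => ?_) ?_)
  · simpa [hu] using congrArg (fun x : EuclideanSpace ℝ V => x i) h
  · have h := inner_eigenvectorBasis_adjMatrix (G := G) j u
    rw [hAu, real_inner_smul_right, ← sub_eq_zero, ← sub_mul, real_inner_comm] at h
    refine (mul_eq_zero.1 h).resolve_left (sub_ne_zero.2 fun hd => ?_)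
    exact (((le_abs_self _).trans (hi₀ j hj)).trans_lt hG.2.2.1).ne hd.symm
  · simpa [hu, PiLp.inner_apply] using hf

variable {q : ℕ} {ρ : ℝ}

lemma abs_endSum_self_le (hG : IsNDLGraph G n (q + 1) lam) (hq : 1 ≤ q) (hρ : 0 < ρ)
    (hρq : q ≤ ρ ^ 2) (hlam : lam ≤ ρ + q / ρ) {f : V → ℝ} (hf : ∑ v, f v = 0) (t : ℕ) (v : V) :
    |endSum G f t (v, v)| ≤ (2 * t + 1) * ρ ^ t * ‖WithLp.toLp 2 f‖ := by
  have hnorm := (isWalkRecurrence_endSum hG.2.1 f).norm_le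
    (adjMatrix_isHermitian G).eigenvectorBasis inner_eigenvectorBasis_adjMatrix
    (by exact_mod_cast hq) hρ hρq
    (fun i => (inner_eq_zero_or_abs_eigenvalues_le hG hf i).imp_right hlam.trans') t
  exact (PiLp.norm_apply_le (WithLp.toLp 2 fun v => endSum G f t (v, v)) v).trans hnorm

lemma abs_endSum_le (hG : IsNDLGraph G n (q + 1) lam) (hq : 1 ≤ q) (hρ : 0 < ρ)
    (hρq : q ≤ ρ ^ 2) (hlam : lam ≤ ρ + q / ρ) {f : V → ℝ} (hf : ∑ v, f v = 0) (t : ℕ) {u v : V}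
    (h : G.Adj u v) : |endSum G f t (u, v)| ≤ (t + 1) ^ 2 * ρ ^ t * ‖WithLp.toLp 2 f‖ := by
  have hρ1 : 1 ≤ ρ := by
    have : (1 : ℝ) ≤ q := by exact_mod_cast hq
    nlinarith
  induction t generalizing u v with
  | zero => simpa [endSum, walkSum, finalState] using PiLp.norm_apply_le (WithLp.toLp 2 f) v
  | succ t ih =>
    set N := ‖WithLp.toLp 2 f‖
    calc |endSum G f (t + 1) (u, v)|
        ≤ |endSum G f (t + 1) (v, v)| + |endSum G f t (v, u)| := by
          rw [endSum_succ_of_adj f t h]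
          exact abs_sub _ _
      _ ≤ (2 * (t + 1 : ℕ) + 1) * ρ ^ (t + 1) * N + (t + 1) ^ 2 * ρ ^ t * N :=
          add_le_add (abs_endSum_self_le hG hq hρ hρq hlam hf (t + 1) v) (ih h.symm)
      _ ≤ (2 * (t + 1 : ℕ) + 1) * ρ ^ (t + 1) * N + (t + 1) ^ 2 * ρ ^ (t + 1) * N := by
          gcongr
          exact t.le_succ
      _ = ((t + 1 : ℕ) + 1) ^ 2 * ρ ^ (t + 1) * N := by push_cast; ring

end Spectral

section HitProb

variable {V : Type*} [Fintype V] [DecidableEq V] (G : SimpleGraph V) [DecidableRel G.Adj]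

/-- The probability that a non-backtracking random walk from the state `p` is in `A` after `t`
steps. -/
noncomputable def hitProb (t : ℕ) (p : V × V) (A : Finset V) : ℝ :=
  walkProb G t p fun l => (finalState p l).2 ∈ A

/-- From time `τ` on, the walk is within relative error `ε` of uniform, whatever the edge along
which it started. -/
def IsMixingTime (τ : ℕ) (ε : ℝ) : Prop :=
  ∀ t ≥ τ, ∀ p : V × V, G.Adj p.1 p.2 → ∀ x,
    |hitProb G t p {x} - 1 / Fintype.card V| ≤ ε / Fintype.card V

variable {G}

lemma hitProb_add (s t : ℕ) (p : V × V) (A : Finset V) :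
    hitProb G (s + t) p A = walkExp G s p fun l => hitProb G t (finalState p l) A := by
  simp only [hitProb, walkProb_append, finalState_append]

lemma hitProb_eq_sum (t : ℕ) (p : V × V) (A : Finset V) :
    hitProb G t p A = ∑ x ∈ A, hitProb G t p {x} := by
  simp only [hitProb, walkProb, mem_singleton]
  rw [← walkExp_sum]
  congr with l
  rw [sum_ite_eq]
  congr

lemma sum_hitProb (hG : ∀ v, 2 ≤ G.degree v) (t : ℕ) (p : V × V) :
    ∑ x, hitProb G t p {x} = 1 := by
  rw [← hitProb_eq_sum, ← walkExp_const hG t p 1]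
  exact walkExp_congr fun l _ _ => if_pos (mem_univ _)

lemma IsMixingTime.abs_hitProb_sub_le {τ : ℕ} {ε : ℝ} (h : IsMixingTime G τ ε) {t : ℕ} (ht : τ ≤ t)
    {p : V × V} (hp : G.Adj p.1 p.2) (A : Finset V) :
    |hitProb G t p A - #A / Fintype.card V| ≤ ε * (#A / Fintype.card V) := by
  calc |hitProb G t p A - #A / Fintype.card V|
      = |∑ x ∈ A, (hitProb G t p {x} - 1 / Fintype.card V)| := by
        rw [sum_sub_distrib, ← hitProb_eq_sum, sum_const, nsmul_eq_mul, mul_one_div]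
    _ ≤ ∑ x ∈ A, |hitProb G t p {x} - 1 / Fintype.card V| := abs_sum_le_sum_abs _ _
    _ ≤ #A • (ε / Fintype.card V) := sum_le_card_nsmul _ _ _ fun x _ => h t ht p hp x
    _ = ε * (#A / Fintype.card V) := by rw [nsmul_eq_mul]; ring

end HitProb

section Return

variable {V : Type*} [Fintype V] [DecidableEq V] {G : SimpleGraph V} [DecidableRel G.Adj] {q : ℕ}

lemma hitProb_singleton_le_inv_pow (hG : G.IsRegularOfDegree (q + 1)) (hq : 1 ≤ q) {r : ℕ}
    (hr : 2 * r < G.girth) {p : V × V} (hp : G.Adj p.1 p.2) (x : V) :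
    hitProb G r p {x} ≤ ((q : ℝ) ^ r)⁻¹ := by
  classical
  have hcard : #{f : Fin r → V | IsContinuation G p (List.ofFn f) ∧
      (finalState p (List.ofFn f)).2 ∈ ({x} : Finset V)} ≤ 1 := by
    refine card_le_one.2 fun f hf f' hf' => List.ofFn_injective ?_
    simp only [mem_filter, mem_univ, true_and, mem_singleton] at hf hf'
    exact hf.1.eq_of_length_lt_girth hf'.1 (hf.2.trans hf'.2.symm) (by simpa [← two_mul] using hr)
  rw [inv_eq_one_div, le_div_iff₀' (by positivity), hitProb, walkProb, ← walkSum_eq_of_adj hG r hp,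
    walkSum_eq_sum]
  refine le_trans (Eq.le ?_) (Nat.cast_le_one.2 hcard)
  rw [← filter_filter, ← sum_boole]
  congr!

lemma hitProb_return_le_inv_pow (hG : G.IsRegularOfDegree (q + 1)) (hq : 1 ≤ q) {r : ℕ}
    (hr : 2 * r < G.girth) {p : V × V} (hp : G.Adj p.1 p.2) {t : ℕ} (ht : t ≠ 0) :
    hitProb G t p {p.2} ≤ ((q : ℝ) ^ r)⁻¹ := by
  rcases lt_or_ge t G.girth with hlt | hge
  · have hzero : hitProb G t p {p.2} ≤ walkExp G t p fun _ => 0 := by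
      refine walkExp_mono fun l hl hc => (if_neg fun hend => ht ?_).le
      rw [← hl, hc.eq_of_length_lt_girth (l' := []) trivial (mem_singleton.1 hend)
        (by simpa [hl] using hlt), List.length_nil]
    rw [walkExp_zero] at hzero
    exact hzero.trans (by positivity)
  · obtain ⟨s, rfl⟩ : ∃ s, t = s + r := ⟨t - r, by lia⟩
    rw [hitProb_add, ← walkExp_const (fun v => by rw [hG v]; lia) s p ((q : ℝ) ^ r)⁻¹]
    exact walkExp_mono fun l _ hc =>
      hitProb_singleton_le_inv_pow hG hq hr (hc.adj_finalState hp) _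

lemma hitProb_return_le (hG : G.IsRegularOfDegree (q + 1)) (hq : 2 ≤ q) {y : ℝ} (hy : 1 < y)
    (hgirth : 2 * Real.logb q y ≤ G.girth) {p : V × V} (hp : G.Adj p.1 p.2) {t : ℕ} (ht : t ≠ 0) :
    hitProb G t p {p.2} ≤ q / y := by
  have hq' : (1 : ℝ) < q := by exact_mod_cast hq
  obtain ⟨r, hr⟩ : ∃ r, ⌈Real.logb q y⌉₊ = r + 1 :=
    Nat.exists_eq_add_one.2 (Nat.ceil_pos.2 (Real.logb_pos hq' hy))
  have hrlt : (r : ℝ) < Real.logb q y := Nat.lt_ceil.1 (by lia)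
  have hyle : y ≤ q ^ r * q := by
    calc y = (q : ℝ) ^ Real.logb q y :=
          (Real.rpow_logb (by linarith) hq'.ne' (by linarith)).symm
      _ ≤ (q : ℝ) ^ ((r + 1 : ℕ) : ℝ) :=
          Real.rpow_le_rpow_of_exponent_le hq'.le (hr ▸ Nat.le_ceil _)
      _ = q ^ r * q := by rw [Real.rpow_natCast, pow_succ]
  refine (hitProb_return_le_inv_pow hG (by lia) (r := r) ?_ hp ht).trans ?_
  · exact_mod_cast (by linarith : 2 * (r : ℝ) < G.girth)
  · rwa [inv_eq_one_div, div_le_div_iff₀ (by positivity) (by linarith), one_mul, mul_comm]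

end Return

section Mixing

lemma exists_eventually_sq_mul_pow_le {κ : ℝ} (hκ0 : 0 < κ) (hκ1 : κ < 1) :
    ∃ C : ℝ, 0 < C ∧ ∀ᶠ n : ℕ in atTop, ∀ t : ℕ, C * Real.log n ≤ t →
      ((t : ℝ) + 1) ^ 2 * κ ^ t ≤ 1 / (n : ℝ) / n := by
  set s := √κ
  have hs0 : 0 < s := Real.sqrt_pos.2 hκ0
  have hs1 : s < 1 := (Real.sqrt_lt' one_pos).2 (by simpa using hκ1)
  have hlog : 0 < -Real.log s := neg_pos.2 (Real.log_neg hs0 hs1)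
  have hpoly : ∀ᶠ t : ℕ in atTop, ((t : ℝ) + 1) ^ 2 * s ^ t < 1 := by
    have h := (tendsto_add_atTop_iff_nat 1).2
      (tendsto_pow_const_mul_const_pow_of_abs_lt_one 2 (by rwa [abs_of_pos hs0] : |s| < 1))
    filter_upwards [h.eventually_lt_const hs0] with t ht
    push_cast at ht
    rw [pow_succ s, ← mul_assoc] at ht
    exact (mul_lt_iff_lt_one_left hs0).1 ht
  obtain ⟨T, hT⟩ := eventually_atTop.1 hpoly
  refine ⟨2 / -Real.log s, by positivity, ?_⟩
  have hlogn := (Real.tendsto_log_atTop.comp tendsto_natCast_atTop_atTop).const_mul_atTop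
    (by positivity : 0 < 2 / -Real.log s)
  filter_upwards [eventually_gt_atTop 0, hlogn.eventually_ge_atTop (T : ℝ)] with n hn hTn t ht
  have hn' : (0 : ℝ) < n := by exact_mod_cast hn
  have hpow : s ^ t ≤ 1 / (n : ℝ) / n := by
    rw [← Real.log_le_log_iff (by positivity) (by positivity), Real.log_pow, div_div, one_div,
      Real.log_inv, Real.log_mul hn'.ne' hn'.ne']
    rw [div_mul_eq_mul_div, div_le_iff₀ hlog] at ht
    linarith
  calc ((t : ℝ) + 1) ^ 2 * κ ^ t = ((t : ℝ) + 1) ^ 2 * s ^ t * s ^ t := by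
        rw [mul_assoc, ← mul_pow, Real.mul_self_sqrt hκ0.le]
    _ ≤ 1 * (1 / (n : ℝ) / n) := by
        gcongr
        exact (hT t (by exact_mod_cast hTn.trans ht)).le
    _ = 1 / (n : ℝ) / n := one_mul _

lemma exists_lt_le_add_div {q lam : ℝ} (hq : 1 < q) (hlam : lam < q + 1) :
    ∃ ρ, 0 < ρ ∧ ρ < q ∧ q ≤ ρ ^ 2 ∧ lam ≤ ρ + q / ρ := by
  have hsum : Tendsto (fun ρ => ρ + q / ρ) (𝓝[<] q) (𝓝 (q + q / q)) :=
    (tendsto_id.add (tendsto_const_nhds.div tendsto_id (by positivity))).mono_left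
      nhdsWithin_le_nhds
  have hsq : Tendsto (fun ρ => ρ ^ 2) (𝓝[<] q) (𝓝 (q ^ 2)) :=
    (tendsto_id.pow 2).mono_left nhdsWithin_le_nhds
  rw [div_self (by positivity)] at hsum
  have hpos : ∀ᶠ ρ in 𝓝[<] q, 0 < ρ := eventually_nhdsWithin_of_eventually_nhds
    (lt_mem_nhds (by positivity))
  have hroot := hsq.eventually_const_le (by nlinarith : q < q ^ 2)
  exact (hpos.and (eventually_mem_nhdsWithin.and
    (hroot.and (hsum.eventually_const_le hlam)))).exists

variable {V : Type*} [Fintype V] [DecidableEq V] {G : SimpleGraph V} [DecidableRel G.Adj]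
  {n q : ℕ} {lam ρ : ℝ}

lemma norm_indicator_sub_const_le (x : V) :
    ‖WithLp.toLp 2 fun v => (if v = x then (1 : ℝ) else 0) - 1 / Fintype.card V‖ ≤ 1 := by
  have hcard : (Fintype.card V : ℝ) ≠ 0 := by
    exact_mod_cast (Fintype.card_pos_iff.2 ⟨x⟩).ne'
  rw [EuclideanSpace.norm_eq, Real.sqrt_le_one]
  calc ∑ v, ‖(if v = x then (1 : ℝ) else 0) - 1 / Fintype.card V‖ ^ 2
      = ∑ v, ((if v = x then 1 - 2 / (Fintype.card V : ℝ) else 0) +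
          (1 / (Fintype.card V : ℝ)) ^ 2) := by
        refine sum_congr rfl fun v _ => ?_
        rw [Real.norm_eq_abs, sq_abs]
        split_ifs <;> ring
    _ = 1 - 1 / (Fintype.card V : ℝ) := by
        rw [sum_add_distrib, sum_ite_eq' univ x, if_pos (mem_univ x), sum_const, card_univ,
          nsmul_eq_mul]
        field_simp
        ring
    _ ≤ 1 := sub_le_self _ (by positivity)

lemma abs_hitProb_sub_le (hG : IsNDLGraph G n (q + 1) lam) (hq : 1 ≤ q) (hρ : 0 < ρ)
    (hρq : q ≤ ρ ^ 2) (hlam : lam ≤ ρ + q / ρ) (t : ℕ) {p : V × V} (hp : G.Adj p.1 p.2) (x : V) :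
    |hitProb G t p {x} - 1 / Fintype.card V| ≤ (t + 1) ^ 2 * (ρ / q) ^ t := by
  set f : V → ℝ := fun v => (if v = x then 1 else 0) - 1 / Fintype.card V with hf
  have hmean : ∑ v, f v = 0 := by
    have hcard : (Fintype.card V : ℝ) ≠ 0 := by exact_mod_cast (Fintype.card_pos_iff.2 ⟨x⟩).ne'
    rw [hf, sum_sub_distrib, sum_ite_eq' univ x, if_pos (mem_univ x), sum_const, card_univ,
      nsmul_eq_mul, mul_one_div_cancel hcard, sub_self]
  have hend : endSum G f t p = q ^ t * (hitProb G t p {x} - 1 / Fintype.card V) := by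
    have hE := walkExp_add (G := G) t p (fun l => if (finalState p l).2 ∈ ({x} : Finset V) then 1
      else 0) fun _ => -(1 / (Fintype.card V : ℝ))
    rw [walkExp_const fun v => by rw [hG.2.1 v]; lia] at hE
    rw [endSum, walkSum_eq_of_adj hG.2.1 t hp, sub_eq_add_neg, hitProb, walkProb]
    convert congrArg ((q : ℝ) ^ t * ·) hE using 3
    · simp only [hf, sub_eq_add_neg, mem_singleton]
    · congr!
  have hle := (abs_endSum_le hG hq hρ hρq hlam hmean t hp).trans
    (mul_le_of_le_one_right (by positivity) (norm_indicator_sub_const_le x))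
  rw [hend, abs_mul, abs_of_nonneg (by positivity)] at hle
  rw [div_pow, ← mul_div_assoc, le_div_iff₀' (by positivity)]
  exact hle

lemma exists_eventually_isMixingTime {q : ℕ} (hq : 2 ≤ q) {lam₀ : ℝ} (hlam₀ : lam₀ < q + 1) :
    ∃ C : ℝ, 0 < C ∧ ∀ᶠ n : ℕ in atTop, ∀ (V : Type*) [Fintype V] [DecidableEq V]
      (G : SimpleGraph V) [DecidableRel G.Adj] (lam : ℝ), lam ≤ lam₀ →
      IsNDLGraph G n (q + 1) lam → ∀ τ : ℕ, C * Real.log n ≤ τ → IsMixingTime G τ (1 / n) := by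
  have hq' : (1 : ℝ) < q := by exact_mod_cast hq
  obtain ⟨ρ, hρ, hρlt, hρq, hlamρ⟩ := exists_lt_le_add_div hq' hlam₀
  obtain ⟨C, hC, hdecay⟩ := exists_eventually_sq_mul_pow_le (κ := ρ / q) (by positivity)
    ((div_lt_one (by positivity)).2 hρlt)
  refine ⟨C, hC, ?_⟩
  filter_upwards [hdecay] with n hn V _ _ G _ lam hlam hG τ hτ t ht p hp x
  have ht' : C * Real.log n ≤ t := hτ.trans (by exact_mod_cast ht)
  exact (abs_hitProb_sub_le hG (by lia) hρ hρq (hlam.trans hlamρ) t hp x).trans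
    ((hn t ht').trans_eq (by rw [hG.1]))

end Mixing

/-! ### Sums over visits -/

section Visits

variable {V : Type*} [DecidableEq V]

/-- The sum of `φ w l` over the visits of a list to `A`, where `w` is the vertex visited and `l` is
the part of the list that follows the visit. Iterating it gives the moments of the number of
visits. -/
def sumOverVisits (A : Finset V) (φ : V → List V → ℝ) : List V → ℝ
  | [] => 0
  | w :: l => (if w ∈ A then φ w l else 0) + sumOverVisits A φ l

lemma sumOverVisits_nonneg {A : Finset V} {φ : V → List V → ℝ} (hφ : ∀ w l, 0 ≤ φ w l)
    (l : List V) : 0 ≤ sumOverVisits A φ l := by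
  induction l with
  | nil => exact le_rfl
  | cons w l ih =>
    rw [sumOverVisits]
    split_ifs
    exacts [add_nonneg (hφ w l) ih, by rwa [zero_add]]

lemma sumOverVisits_one (A : Finset V) (l : List V) :
    sumOverVisits A (fun _ _ => 1) l = l.countP (· ∈ A) := by
  induction l with
  | nil => simp [sumOverVisits]
  | cons w l ih => simp [sumOverVisits, List.countP_cons, ih, add_comm]

lemma sq_countP_eq_sumOverVisits (A : Finset V) (l : List V) :
    (l.countP (· ∈ A) : ℝ) ^ 2 =
      sumOverVisits A (fun _ l => 1 + 2 * (l.countP (· ∈ A) : ℝ)) l := by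
  induction l with
  | nil => simp [sumOverVisits]
  | cons w l ih =>
    rw [sumOverVisits, ← ih, List.countP_cons]
    by_cases h : w ∈ A <;> simp only [h, decide_true, decide_false, if_true, if_false]
    · push_cast
      ring
    · simp

lemma countP_le_card_add_sumOverVisits (A : Finset V) (l : List V) :
    (l.countP (· ∈ A) : ℝ) ≤ #{x ∈ A | x ∈ l} + sumOverVisits A (fun w l => l.count w) l := by
  induction l with
  | nil => simp [sumOverVisits]
  | cons w l ih =>
    have hsub : {x ∈ A | x ∈ l} ⊆ {x ∈ A | x ∈ w :: l} :=
      monotone_filter_right A fun x _ hx => List.mem_cons_of_mem w hx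
    have hcard : (#{x ∈ A | x ∈ l} : ℝ) ≤ #{x ∈ A | x ∈ w :: l} := mod_cast card_le_card hsub
    rw [sumOverVisits, List.countP_cons]
    by_cases hA : w ∈ A
    · have hnew : (#{x ∈ A | x ∈ l} : ℝ) + 1 ≤ #{x ∈ A | x ∈ w :: l} + l.count w := by
        by_cases hl : w ∈ l
        · exact add_le_add hcard (mod_cast List.count_pos_iff.2 hl)
        · have hlt : #{x ∈ A | x ∈ l} < #{x ∈ A | x ∈ w :: l} :=
            card_lt_card ((ssubset_iff_of_subset hsub).2 ⟨w, by simp [hA], by simp [hl]⟩)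
          exact le_add_of_le_of_nonneg (mod_cast hlt) (Nat.cast_nonneg _)
      simp only [hA, decide_true, if_true, Nat.cast_add, Nat.cast_one]
      linarith
    · simp only [hA, decide_false, Bool.false_eq_true, if_false, Nat.add_zero]
      linarith

lemma ite_succ_le_count_le_sumOverVisits (m : ℕ) (x : V) (l : List V) :
    (if m + 1 ≤ l.count x then (1 : ℝ) else 0) ≤
      sumOverVisits {x} (fun _ l => if m ≤ l.count x then 1 else 0) l := by
  have hnonneg := sumOverVisits_nonneg (A := {x})
    (φ := fun _ l => if m ≤ l.count x then (1 : ℝ) else 0) fun _ _ => by positivity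
  induction l with
  | nil => simp [sumOverVisits]
  | cons w l ih =>
    rw [sumOverVisits]
    by_cases hw : w = x
    · have := hnonneg l
      simp only [hw, List.count_cons_self, Nat.add_le_add_iff_right, mem_singleton, if_true]
      linarith
    · simpa [hw] using ih

variable [Fintype V] {G : SimpleGraph V} [DecidableRel G.Adj]

lemma walkExp_sumOverVisits (A : Finset V) (φ : V → List V → ℝ) (M : ℕ) (p : V × V) :
    walkExp G M p (sumOverVisits A φ) = ∑ t ∈ range M, walkExp G (t + 1) p fun l =>
      if (finalState p l).2 ∈ A then
        walkExp G (M - 1 - t) (finalState p l) (φ (finalState p l).2) else 0 := by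
  induction M generalizing p with
  | zero => rfl
  | succ M ih =>
    have hfirst (w : V) : walkExp G M (p.2, w) (fun l => if w ∈ A then φ w l else 0) =
        if w ∈ A then walkExp G M (p.2, w) (φ w) else 0 := by
      split_ifs
      exacts [rfl, walkExp_zero _ _]
    rw [sum_range_succ']
    rw [walkExp]
    simp only [sumOverVisits, walkExp_add, ih, hfirst, sum_add_distrib, add_div]
    rw [add_comm, sum_comm, sum_div]
    simp only [walkExp, finalState, Nat.add_sub_cancel, Nat.sub_zero, Nat.sub_sub, add_comm 1]

lemma walkExp_sumOverVisits_le {A : Finset V} {φ : V → List V → ℝ} {M : ℕ} {c : ℕ → ℝ}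
    (h : ∀ k < M, ∀ e : V × V, G.Adj e.1 e.2 → e.2 ∈ A → walkExp G k e (φ e.2) ≤ c k)
    (p : V × V) :
    walkExp G M p (sumOverVisits A φ) ≤
      ∑ t ∈ range M, hitProb G (t + 1) p A * c (M - 1 - t) := by
  rw [walkExp_sumOverVisits]
  refine sum_le_sum fun t ht => ?_
  rw [mul_comm, hitProb, walkProb, ← walkExp_const_mul]
  refine walkExp_mono fun l hl hc => ?_
  have hedge := hc.adj_finalState_of_ne_nil (List.ne_nil_of_length_eq_add_one hl)
  split_ifs with hA
  · simpa using h _ (by have := mem_range.1 ht; lia) _ hedge hA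
  · simp

lemma walkExp_countP (hG : ∀ v, 2 ≤ G.degree v) (A : Finset V) (M : ℕ) (p : V × V) :
    walkExp G M p (fun l => (l.countP (· ∈ A) : ℝ)) =
      ∑ t ∈ range M, hitProb G (t + 1) p A := by
  simp only [← sumOverVisits_one]
  rw [walkExp_sumOverVisits]
  simp only [walkExp_const hG, hitProb, walkProb]
  congr!

lemma walkExp_count (hG : ∀ v, 2 ≤ G.degree v) (x : V) (M : ℕ) (p : V × V) :
    walkExp G M p (fun l => (l.count x : ℝ)) = ∑ t ∈ range M, hitProb G (t + 1) p {x} := by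
  rw [← walkExp_countP hG]
  congr! 3 with l
  rw [List.count]
  congr! 2
  simp [beq_eq_decide]

lemma walkExp_sum_hitProb_mul (s : ℕ) (p : V × V) (A : Finset V) (M : ℕ) (g : ℕ → ℝ) :
    walkExp G s p (fun l => ∑ t ∈ range M, hitProb G (t + 1) (finalState p l) A * g t) =
      ∑ t ∈ range M, hitProb G (s + (t + 1)) p A * g t := by
  rw [walkExp_sum]
  refine sum_congr rfl fun t _ => ?_
  rw [hitProb_add, mul_comm, ← walkExp_const_mul]
  simp only [mul_comm]

end Visits

/-! ### Many visits to a vertex -/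

section UpperTail

variable {V : Type*} [Fintype V] [DecidableEq V] {G : SimpleGraph V} [DecidableRel G.Adj]
  {T : ℕ} {z β : ℝ}

lemma walkProb_succ_le_count_le {m : ℕ} {x : V} {B : ℕ → ℝ}
    (hB : ∀ k < T, ∀ e : V × V, G.Adj e.1 e.2 → e.2 = x →
      walkProb G k e (fun l => m ≤ l.count x) ≤ B k) (p : V × V) :
    walkProb G T p (fun l => m + 1 ≤ l.count x) ≤
      ∑ t ∈ range T, hitProb G (t + 1) p {x} * B (T - 1 - t) := by
  refine le_trans (walkExp_mono fun l _ _ => ?_) (walkExp_sumOverVisits_le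
    (φ := fun _ l => if m ≤ l.count x then 1 else 0) (fun k hk e he hx => ?_) p)
  · convert ite_succ_le_count_le_sumOverVisits m x l
  · refine le_trans (Eq.le ?_) (hB k hk e he (mem_singleton.1 hx))
    rw [walkProb]
    congr!

lemma walkProb_le_count_self_le (hG : ∀ v, 2 ≤ G.degree v) (hz : 1 ≤ z)
    (hβ : ∀ T, ∀ e : V × V, G.Adj e.1 e.2 →
      ∑ t ∈ range T, hitProb G (t + 1) e {e.2} * (z ^ (t + 1))⁻¹ ≤ β)
    (m : ℕ) (T : ℕ) {e : V × V} (he : G.Adj e.1 e.2) :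
    walkProb G T e (fun l => m ≤ l.count e.2) ≤ z ^ T * β ^ m := by
  have hβ0 : 0 ≤ β := by simpa using hβ 0 e he
  induction m generalizing T e with
  | zero =>
    rw [pow_zero, mul_one]
    exact (walkProb_le_one hG _ _ _).trans (one_le_pow₀ hz)
  | succ m ih =>
    calc walkProb G T e (fun l => m + 1 ≤ l.count e.2)
        ≤ ∑ t ∈ range T, hitProb G (t + 1) e {e.2} * (z ^ (T - 1 - t) * β ^ m) :=
          walkProb_succ_le_count_le (B := fun k => z ^ k * β ^ m)
            (fun k _ e' he' hx => hx ▸ ih k he') e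
      _ = z ^ T * β ^ m * ∑ t ∈ range T, hitProb G (t + 1) e {e.2} * (z ^ (t + 1))⁻¹ := by
          rw [mul_sum]
          refine sum_congr rfl fun t ht => ?_
          have hlt : t + 1 ≤ T := mem_range.1 ht
          rw [Nat.sub_sub, add_comm 1 t, pow_sub₀ z (by positivity) hlt]
          ring
      _ ≤ z ^ T * β ^ m * β := by gcongr; exact hβ T e he
      _ = z ^ T * β ^ (m + 1) := by rw [pow_succ, mul_assoc]

lemma walkProb_exists_lt_count_le (hG : ∀ v, 2 ≤ G.degree v) (hz : 1 ≤ z) (hβ0 : 0 ≤ β)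
    (hβ : ∀ T, ∀ e : V × V, G.Adj e.1 e.2 →
      ∑ t ∈ range T, hitProb G (t + 1) e {e.2} * (z ^ (t + 1))⁻¹ ≤ β)
    (m T : ℕ) (p : V × V) :
    walkProb G T p (fun l => ∃ x, m < l.count x) ≤ T * (z ^ T * β ^ m) := by
  classical
  calc walkProb G T p (fun l => ∃ x, m < l.count x)
      ≤ walkExp G T p fun l => ∑ x, if m + 1 ≤ l.count x then 1 else 0 := by
        refine walkProb_le_walkExp (fun l => by positivity) fun l _ ⟨x, hx⟩ => ?_
        exact (if_pos hx).ge.trans (single_le_sum (f := fun x => if m + 1 ≤ l.count x then (1 : ℝ)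
          else 0) (fun x _ => by positivity) (mem_univ x))
    _ = ∑ x, walkProb G T p (fun l => m + 1 ≤ l.count x) := by
        rw [walkExp_sum]
        simp only [walkProb]
        congr!
    _ ≤ ∑ x, ∑ t ∈ range T, hitProb G (t + 1) p {x} * (z ^ T * β ^ m) :=
        sum_le_sum fun x _ => walkProb_succ_le_count_le (B := fun _ => z ^ T * β ^ m)
          (fun k hk e he hx => hx ▸ (walkProb_le_count_self_le hG hz hβ m k he).trans (by gcongr)) p
    _ = T * (z ^ T * β ^ m) := by
        rw [sum_comm]
        simp only [← sum_mul, sum_hitProb hG, sum_const, card_range, nsmul_eq_mul, mul_one]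

end UpperTail

/-! ### Mixing and the moments of the number of visits -/

section Moments

lemma sum_range_mul_le {f w : ℕ → ℝ} {ε c : ℝ} {τ : ℕ} (hε : 0 ≤ ε) (hc : 0 ≤ c)
    (hshort : ∀ t, f t ≤ ε) (hlong : ∀ t ≥ τ, f t ≤ c) (hw : ∀ t, 0 ≤ w t) (hw1 : ∀ t, w t ≤ 1)
    (T : ℕ) : ∑ t ∈ range T, f t * w t ≤ τ * ε + c * ∑ t ∈ range T, w t := by
  calc ∑ t ∈ range T, f t * w t
      ≤ ∑ t ∈ range T, ((if t ∈ range τ then ε else 0) + c * w t) := by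
        refine sum_le_sum fun t _ => ?_
        split_ifs with h
        · have := mul_le_mul (hshort t) (hw1 t) (hw t) hε
          linarith [mul_nonneg hc (hw t)]
        · rw [zero_add]
          exact mul_le_mul_of_nonneg_right (hlong t (by simpa using h)) (hw t)
    _ = ∑ _t ∈ range T ∩ range τ, ε + c * ∑ t ∈ range T, w t := by
        rw [sum_add_distrib, sum_ite_mem, mul_sum]
    _ ≤ ∑ _t ∈ range τ, ε + c * ∑ t ∈ range T, w t :=
        add_le_add_left
          (sum_le_sum_of_subset_of_nonneg inter_subset_right fun _ _ _ => hε) _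
    _ = τ * ε + c * ∑ t ∈ range T, w t := by rw [sum_const, card_range, nsmul_eq_mul]

lemma sum_range_inv_pow_succ_le {z : ℝ} (hz : 1 < z) (T : ℕ) :
    ∑ t ∈ range T, (z ^ (t + 1))⁻¹ ≤ 1 / (z - 1) := by
  have h : ∑ t ∈ range T, (z ^ (t + 1))⁻¹ = (1 - (z ^ T)⁻¹) / (z - 1) := by
    induction T with
    | zero => simp
    | succ T ih =>
      have : z - 1 ≠ 0 := by linarith
      rw [sum_range_succ, ih]
      field_simp
      ring
  rw [h]
  exact div_le_div_of_nonneg_right (sub_le_self _ (by positivity)) (by linarith)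

variable {V : Type*} [Fintype V] [DecidableEq V] {G : SimpleGraph V} [DecidableRel G.Adj]
  {τ : ℕ} {ε r : ℝ}

lemma sum_hitProb_return_mul_le (hmix : IsMixingTime G τ ε) (hε : 0 ≤ ε) (hr : 0 ≤ r)
    (hreturn : ∀ t ≠ 0, ∀ e : V × V, G.Adj e.1 e.2 → hitProb G t e {e.2} ≤ r)
    {w : ℕ → ℝ} (hw : ∀ t, 0 ≤ w t) (hw1 : ∀ t, w t ≤ 1) (T : ℕ) {e : V × V} (he : G.Adj e.1 e.2) :
    ∑ t ∈ range T, hitProb G (t + 1) e {e.2} * w t ≤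
      τ * r + (1 + ε) / Fintype.card V * ∑ t ∈ range T, w t := by
  refine sum_range_mul_le hr (by positivity) (fun t => hreturn _ t.succ_ne_zero e he)
    (fun t ht => ?_) hw hw1 T
  have := (abs_le.1 (hmix (t + 1) (by lia) e he e.2)).2
  rw [add_div]
  linarith

lemma walkExp_countP_le (hG : ∀ v, 2 ≤ G.degree v) {A : Finset V} {a : ℝ} (ha : 0 ≤ a)
    (hA : ∀ t ≥ τ, ∀ e : V × V, G.Adj e.1 e.2 → hitProb G t e A ≤ a) (M : ℕ) {e : V × V}
    (he : G.Adj e.1 e.2) :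
    walkExp G M e (fun l => (l.countP (· ∈ A) : ℝ)) ≤ τ + M * a := by
  have h := sum_range_mul_le (f := fun t => hitProb G (t + 1) e A) (w := fun _ => 1) (τ := τ)
    zero_le_one ha (fun t => walkProb_le_one hG _ _ _) (fun t ht => hA _ (by lia) e he)
    (fun _ => zero_le_one) (fun _ => le_rfl) M
  rw [walkExp_countP hG]
  simpa [mul_comm a] using h

-- Expanding the square over the visits, each visit is paired with the later ones, of which it
-- expects at most `τ + k * a` in the `k` remaining steps.
lemma walkExp_walkExp_sq_countP_le (hG : ∀ v, 2 ≤ G.degree v) {A : Finset V} {a : ℝ} (ha : 0 ≤ a)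
    (hA : ∀ t ≥ τ, ∀ e : V × V, G.Adj e.1 e.2 → hitProb G t e A ≤ a) (M : ℕ) {e : V × V}
    (he : G.Adj e.1 e.2) :
    walkExp G τ e (fun l => walkExp G M (finalState e l) fun l' => (l'.countP (· ∈ A) : ℝ) ^ 2) ≤
      M * a * (1 + 2 * τ) + (M * a) ^ 2 := by
  have hlater (k : ℕ) {e : V × V} (he : G.Adj e.1 e.2) :
      walkExp G k e (fun l => 1 + 2 * (l.countP (· ∈ A) : ℝ)) ≤ 1 + 2 * (τ + k * a) := by
    rw [walkExp_add, walkExp_const hG, walkExp_const_mul]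
    gcongr
    exact walkExp_countP_le hG ha hA k he
  simp only [sq_countP_eq_sumOverVisits]
  calc _ ≤ walkExp G τ e fun l => ∑ t ∈ range M,
          hitProb G (t + 1) (finalState e l) A * (1 + 2 * (τ + (M - 1 - t : ℕ) * a)) :=
        walkExp_mono fun l _ _ => walkExp_sumOverVisits_le
          (c := fun k => 1 + 2 * (τ + k * a)) (fun k _ e he _ => hlater k he) _
    _ = ∑ t ∈ range M, hitProb G (τ + (t + 1)) e A * (1 + 2 * (τ + (M - 1 - t : ℕ) * a)) :=
        walkExp_sum_hitProb_mul _ _ _ _ fun t => 1 + 2 * (τ + (M - 1 - t : ℕ) * a)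
    _ ≤ ∑ t ∈ range M, a * (1 + 2 * (τ + (M - 1 - t : ℕ) * a)) := by
        gcongr
        exact hA _ (by lia) e he
    _ = ∑ k ∈ range M, a * (1 + 2 * (τ + k * a)) :=
        sum_range_reflect (fun k : ℕ => a * (1 + 2 * (τ + k * a))) M
    _ ≤ M * a * (1 + 2 * τ) + (M * a) ^ 2 := by
        induction M with
        | zero => simp
        | succ M ih =>
          rw [sum_range_succ]
          push_cast
          nlinarith [sq_nonneg a]

lemma abs_walkExp_walkExp_countP_sub_le (hG : ∀ v, 2 ≤ G.degree v) (hmix : IsMixingTime G τ ε)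
    (A : Finset V) (M : ℕ) {e : V × V} (he : G.Adj e.1 e.2) :
    |walkExp G τ e (fun l => walkExp G M (finalState e l) fun l' => (l'.countP (· ∈ A) : ℝ)) -
      M * (#A / Fintype.card V)| ≤ ε * (M * (#A / Fintype.card V)) := by
  have hsum := walkExp_sum_hitProb_mul (G := G) τ e A M fun _ => 1
  simp only [mul_one] at hsum
  simp only [walkExp_countP hG]
  calc _ = |∑ t ∈ range M, (hitProb G (τ + (t + 1)) e A - #A / Fintype.card V)| := by
        rw [hsum, sum_sub_distrib, sum_const, card_range, nsmul_eq_mul]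
    _ ≤ ∑ t ∈ range M, |hitProb G (τ + (t + 1)) e A - #A / Fintype.card V| :=
        abs_sum_le_sum_abs _ _
    _ ≤ ∑ _t ∈ range M, ε * (#A / Fintype.card V) :=
        sum_le_sum fun t _ => hmix.abs_hitProb_sub_le (by lia) he A
    _ = ε * (M * (#A / Fintype.card V)) := by
        rw [sum_const, card_range, nsmul_eq_mul, mul_left_comm]

lemma walkExp_walkExp_sq_countP_sub_le (hG : ∀ v, 2 ≤ G.degree v) (hmix : IsMixingTime G τ ε)
    (hε0 : 0 ≤ ε) (hε1 : ε ≤ 1) {A : Finset V} {M : ℕ} {μ : ℝ}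
    (hμ : μ = M * (#A / Fintype.card V)) {e : V × V} (he : G.Adj e.1 e.2) :
    walkExp G τ e (fun l => walkExp G M (finalState e l) fun l' =>
      ((l'.countP (· ∈ A) : ℝ) - μ) ^ 2) ≤ 2 * μ * (1 + 2 * τ) + 5 * μ ^ 2 * ε := by
  have hμ0 : 0 ≤ μ := hμ ▸ by positivity
  have hfirst := (abs_le.1 (abs_walkExp_walkExp_countP_sub_le hG hmix A M he)).1
  have hsecond := walkExp_walkExp_sq_countP_le hG (A := A)
    (a := #A / Fintype.card V + ε * (#A / Fintype.card V)) (by positivity)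
    (fun t ht e he => by linarith [(abs_le.1 (hmix.abs_hitProb_sub_le ht he A)).2]) M he
  rw [mul_add (M : ℝ), mul_left_comm (M : ℝ), ← hμ] at hsecond
  rw [← hμ] at hfirst
  have hexpand (c : ℝ) : (c - μ) ^ 2 = c ^ 2 + (-(2 * μ) * c + μ ^ 2) := by ring
  simp only [hexpand, walkExp_add, walkExp_const_mul, walkExp_const hG]
  have hε : ε ^ 2 ≤ ε := by nlinarith
  have := mul_le_mul_of_nonneg_left hfirst hμ0
  have := mul_le_mul_of_nonneg_left hε (sq_nonneg μ)
  have := mul_le_mul_of_nonneg_right hε1 (by positivity : 0 ≤ μ * (1 + 2 * τ))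
  nlinarith

end Moments

/-! ### Vertices visited in a phase -/

section Phase

variable {V : Type*} [Fintype V] [DecidableEq V] {G : SimpleGraph V} [DecidableRel G.Adj]
  {τ M : ℕ} {ε σ : ℝ}

lemma walkExp_sumOverVisits_count_le (hG : ∀ v, 2 ≤ G.degree v)
    (hσ : ∀ k < M, ∀ e : V × V, G.Adj e.1 e.2 → walkExp G k e (fun l => (l.count e.2 : ℝ)) ≤ σ)
    (A : Finset V) (p : V × V) :
    walkExp G M p (sumOverVisits A fun w l => l.count w) ≤
      σ * walkExp G M p fun l => (l.countP (· ∈ A) : ℝ) := by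
  rw [walkExp_countP hG, mul_comm, sum_mul]
  exact walkExp_sumOverVisits_le (c := fun _ => σ) (fun k hk e he _ => hσ k hk e he) p

lemma one_le_sq_sub_add_of_lt {D Z R μ : ℝ} (hμ : 0 < μ) (hR : 0 ≤ R) (h : Z ≤ D + R)
    (hD : D < μ / 4) : 1 ≤ 4 / μ ^ 2 * (Z - μ) ^ 2 + 4 / μ * R := by
  rcases lt_or_ge Z (μ / 2) with hZ | hZ
  · have hdev : 1 ≤ 4 / μ ^ 2 * (Z - μ) ^ 2 := by
      rw [div_mul_eq_mul_div, le_div_iff₀ (by positivity)]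
      nlinarith
    have : 0 ≤ 4 / μ * R := by positivity
    linarith
  · have hrep : 1 ≤ 4 / μ * R := by
      rw [div_mul_eq_mul_div, le_div_iff₀ hμ]
      linarith
    have : 0 ≤ 4 / μ ^ 2 * (Z - μ) ^ 2 := by positivity
    linarith

lemma walkProb_card_visited_lt_le (hG : ∀ v, 2 ≤ G.degree v) (hmix : IsMixingTime G τ ε)
    (hε0 : 0 ≤ ε) (hε1 : ε ≤ 1) (hσ0 : 0 ≤ σ)
    (hσ : ∀ k < M, ∀ e : V × V, G.Adj e.1 e.2 → walkExp G k e (fun l => (l.count e.2 : ℝ)) ≤ σ)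
    {A : Finset V} {μ : ℝ} (hμ : μ = M * (#A / Fintype.card V)) (hμ0 : 0 < μ) {e : V × V}
    (he : G.Adj e.1 e.2) :
    walkProb G (τ + M) e (fun l => (#{x ∈ A | x ∈ l} : ℝ) < μ / 4) ≤
      8 * (1 + 2 * τ) / μ + 20 * ε + 8 * σ := by
  set E : (List V → ℝ) → ℝ := fun F => walkExp G τ e fun l => walkExp G M (finalState e l) F with hE
  have hvar : E (fun l => ((l.countP (· ∈ A) : ℝ) - μ) ^ 2) ≤
      2 * μ * (1 + 2 * τ) + 5 * μ ^ 2 * ε :=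
    walkExp_walkExp_sq_countP_sub_le hG hmix hε0 hε1 hμ he
  have hmean : E (fun l => (l.countP (· ∈ A) : ℝ)) ≤ 2 * μ := by
    have := (abs_le.1 (abs_walkExp_walkExp_countP_sub_le hG hmix A M he)).2
    rw [← hμ] at this
    linarith [mul_le_of_le_one_left hμ0.le hε1]
  have hrep : E (sumOverVisits A fun w l => l.count w) ≤ 2 * σ * μ := by
    calc E (sumOverVisits A fun w l => l.count w)
        ≤ σ * E (fun l => (l.countP (· ∈ A) : ℝ)) := by
          rw [hE, ← walkExp_const_mul]
          exact walkExp_mono fun l _ _ => walkExp_sumOverVisits_count_le hG hσ A _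
      _ ≤ σ * (2 * μ) := by gcongr
      _ = 2 * σ * μ := by ring
  have hR := sumOverVisits_nonneg (A := A) (φ := fun w l => (l.count w : ℝ)) fun _ _ =>
    Nat.cast_nonneg _
  have hE1 : walkProb G (τ + M) e (fun l => (#{x ∈ A | x ∈ l} : ℝ) < μ / 4) ≤
      E fun l => 4 / μ ^ 2 * ((l.countP (· ∈ A) : ℝ) - μ) ^ 2 +
        4 / μ * sumOverVisits A (fun w l => l.count w) l := by
    rw [walkProb_append]
    refine walkExp_mono fun l _ _ => walkProb_le_walkExp (fun l' => ?_) fun l' _ h => ?_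
    · exact add_nonneg (by positivity) (mul_nonneg (by positivity) (hR l'))
    · refine one_le_sq_sub_add_of_lt hμ0 (hR l') (countP_le_card_add_sumOverVisits A l') ?_
      refine lt_of_le_of_lt (mod_cast card_le_card ?_) h
      exact monotone_filter_right A fun x _ hx => List.mem_append_right l hx
  calc _ ≤ _ := hE1
    _ = 4 / μ ^ 2 * E (fun l => ((l.countP (· ∈ A) : ℝ) - μ) ^ 2) +
          4 / μ * E (sumOverVisits A fun w l => l.count w) := by
        simp only [hE, walkExp_add, walkExp_const_mul]
    _ ≤ 4 / μ ^ 2 * (2 * μ * (1 + 2 * τ) + 5 * μ ^ 2 * ε) + 4 / μ * (2 * σ * μ) := by gcongr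
    _ = 8 * (1 + 2 * τ) / μ + 20 * ε + 8 * σ := by
        field_simp
        ring

end Phase

/-! ### Phases -/

section Phases

lemma card_filter_le_count_append_le {V : Type*} [DecidableEq V] (A : Finset V) (j : ℕ)
    (l l' : List V) :
    #{v ∈ ({v ∈ A | v ∈ l} : Finset V) | j ≤ l'.count v} ≤
      #{v ∈ A | j + 1 ≤ (l ++ l').count v} := by
  refine card_le_card fun v hv => ?_
  simp only [mem_filter, ← List.count_pos_iff, List.count_append] at hv ⊢
  exact ⟨hv.1.1, by lia⟩

variable {V : Type*} [Fintype V] [DecidableEq V] {G : SimpleGraph V} [DecidableRel G.Adj]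
  {T : ℕ} {κ N ζ : ℝ}

lemma walkProb_phases_le (hG : ∀ v, 2 ≤ G.degree v) (hκ0 : 0 ≤ κ) (hκ1 : κ ≤ 1) (hζ : 0 ≤ ζ)
    (hphase : ∀ e : V × V, G.Adj e.1 e.2 → ∀ A : Finset V, N ≤ #A →
      walkProb G T e (fun l => (#{v ∈ A | v ∈ l} : ℝ) < κ * #A) ≤ ζ)
    (j : ℕ) {e : V × V} (he : G.Adj e.1 e.2) {A : Finset V} (hA : N ≤ κ ^ j * #A) :
    walkProb G (j * T) e (fun l => (#{v ∈ A | j ≤ l.count v} : ℝ) < κ ^ j * #A) ≤ j * ζ := by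
  induction j generalizing e A with
  | zero => simp [walkProb, walkExp]
  | succ j ih =>
    have hfirst := hphase e he A (hA.trans
      (mul_le_of_le_one_left (Nat.cast_nonneg _) (pow_le_one₀ hκ0 hκ1)))
    have hlater : ∀ l, l.length = T → IsContinuation G e l → ¬(#{v ∈ A | v ∈ l} : ℝ) < κ * #A →
        walkProb G (j * T) (finalState e l) (fun l' =>
          (#{v ∈ A | j + 1 ≤ (l ++ l').count v} : ℝ) < κ ^ (j + 1) * #A) ≤ j * ζ := by
      intro l _ hl hvisited
      have hremaining : κ ^ (j + 1) * #A ≤ κ ^ j * #{v ∈ A | v ∈ l} := by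
        rw [pow_succ, mul_assoc]
        exact mul_le_mul_of_nonneg_left (not_lt.1 hvisited) (by positivity)
      refine (walkProb_mono fun l' _ _ hfew => ?_).trans
        (ih (hl.adj_finalState he) (hA.trans hremaining))
      exact ((Nat.cast_le.2 (card_filter_le_count_append_le A j l l')).trans_lt hfew).trans_le
        hremaining
    rw [show (j + 1) * T = T + j * T by ring]
    calc _ ≤ walkProb G T e (fun l => (#{v ∈ A | v ∈ l} : ℝ) < κ * #A) + j * ζ :=
          walkProb_append_le hG (by positivity) hlater
      _ ≤ ζ + j * ζ := by gcongr
      _ = (j + 1 : ℕ) * ζ := by push_cast; ring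

lemma walkProb_forall_count_lt_le (hG : ∀ v, 2 ≤ G.degree v) (hκ0 : 0 ≤ κ) (hκ1 : κ ≤ 1)
    (hN : 0 < N) (hζ : 0 ≤ ζ)
    (hphase : ∀ e : V × V, G.Adj e.1 e.2 → ∀ A : Finset V, N ≤ #A →
      walkProb G T e (fun l => (#{v ∈ A | v ∈ l} : ℝ) < κ * #A) ≤ ζ)
    {j k : ℕ} (hk : j * T + 1 ≤ k) (hNj : N ≤ κ ^ j * Fintype.card V) (p : V × V) :
    walkProb G k p (fun l => ∀ x, l.count x < j) ≤ j * ζ := by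
  obtain ⟨r, rfl⟩ := Nat.exists_eq_add_of_le hk
  rw [add_comm _ 1, add_assoc, walkProb_append, ← walkExp_const hG 1 p (j * ζ)]
  refine walkExp_mono fun l₁ hl₁ hcont => ?_
  have hne : l₁ ≠ [] := List.ne_nil_of_length_pos (by lia)
  have hphases := walkProb_phases_le hG hκ0 hκ1 hζ hphase j (hcont.adj_finalState_of_ne_nil hne)
    (A := univ) (by rwa [card_univ])
  refine (walkProb_append_le hG le_rfl fun l _ _ hmany => ?_).trans
    ((add_zero _).trans_le hphases)
  have hpos : (0 : ℝ) < #{v | j ≤ l.count v} := by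
    rw [card_univ] at hmany
    exact (hN.trans_le hNj).trans_le (not_lt.1 hmany)
  obtain ⟨x, hx⟩ := card_pos.1 (Nat.cast_pos.1 hpos)
  refine ((walkExp_congr fun l' _ _ => if_neg fun h => ?_).trans (walkExp_zero _ _)).le
  have := h x
  simp only [List.count_append, mem_filter, mem_univ, true_and] at this hx
  lia

end Phases

/-! ### The maximal number of visits for given parameters -/

section Finitary

variable {V : Type*} [Fintype V] [DecidableEq V] {G : SimpleGraph V} [DecidableRel G.Adj]
  {τ M : ℕ} {ε r : ℝ}

lemma walkProb_exists_lt_count_le_of_isMixingTime (hG : ∀ v, 2 ≤ G.degree v)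
    (hmix : IsMixingTime G τ ε) (hε0 : 0 ≤ ε) (hε1 : ε ≤ 1) (hr : 0 ≤ r)
    (hreturn : ∀ t ≠ 0, ∀ e : V × V, G.Adj e.1 e.2 → hitProb G t e {e.2} ≤ r)
    {θ : ℝ} (hθ : 0 < θ) (m T : ℕ) (p : V × V) :
    walkProb G T p (fun l => ∃ x, m < l.count x) ≤
      T * ((1 + θ) ^ T * (τ * r + 2 / Fintype.card V / θ) ^ m) := by
  refine walkProb_exists_lt_count_le hG (by linarith) (by positivity) (fun k e he => ?_) m T p
  have hz : 1 < 1 + θ := by linarith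
  refine (sum_hitProb_return_mul_le hmix hε0 hr hreturn (fun t => by positivity)
    (fun t => inv_le_one_of_one_le₀ (one_le_pow₀ hz.le)) k he).trans ?_
  have hsum : ∑ t ∈ range k, ((1 + θ) ^ (t + 1))⁻¹ ≤ 1 / θ := by
    simpa using sum_range_inv_pow_succ_le hz k
  rw [div_eq_mul_one_div (2 / _)]
  gcongr
  linarith

lemma walkExp_count_self_le (hG : ∀ v, 2 ≤ G.degree v) (hmix : IsMixingTime G τ ε)
    (hε0 : 0 ≤ ε) (hε1 : ε ≤ 1) (hr : 0 ≤ r)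
    (hreturn : ∀ t ≠ 0, ∀ e : V × V, G.Adj e.1 e.2 → hitProb G t e {e.2} ≤ r)
    (k : ℕ) {e : V × V} (he : G.Adj e.1 e.2) :
    walkExp G k e (fun l => (l.count e.2 : ℝ)) ≤ τ * r + k * (2 / Fintype.card V) := by
  have h := sum_hitProb_return_mul_le hmix hε0 hr hreturn (w := fun _ => 1)
    (fun _ => zero_le_one) (fun _ => le_rfl) k he
  simp only [mul_one, sum_const, card_range, nsmul_eq_mul] at h
  rw [walkExp_count hG, mul_comm (k : ℝ)]
  refine h.trans ?_
  gcongr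
  linarith

/-- A bound for the probability that one phase, of `τ` steps of mixing and `M` further steps, visits
less than the proportion `M / (4 * n)` of a given set of at least `N` of the `n` vertices, when `r`
bounds the probability of a return. -/
noncomputable def phaseError (n : ℝ) (τ M : ℕ) (ε r N : ℝ) : ℝ :=
  8 * (1 + 2 * τ) / (M * (N / n)) + 20 * ε + 8 * (τ * r + M * (2 / n))

lemma walkProb_card_visited_lt_le_phaseError (hG : ∀ v, 2 ≤ G.degree v)
    (hmix : IsMixingTime G τ ε) (hε0 : 0 ≤ ε) (hε1 : ε ≤ 1) (hr : 0 ≤ r)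
    (hreturn : ∀ t ≠ 0, ∀ e : V × V, G.Adj e.1 e.2 → hitProb G t e {e.2} ≤ r)
    (hM : 0 < M) {N : ℝ} (hN : 0 < N) {A : Finset V} (hA : N ≤ #A) {e : V × V}
    (he : G.Adj e.1 e.2) :
    walkProb G (τ + M) e
        (fun l => (#{v ∈ A | v ∈ l} : ℝ) < M / (4 * Fintype.card V) * #A) ≤
      phaseError (Fintype.card V) τ M ε r N := by
  have hcard : (0 : ℝ) < Fintype.card V := by exact_mod_cast Fintype.card_pos_iff.2 ⟨e.1⟩
  have : (0 : ℝ) < M := by exact_mod_cast hM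
  have hA0 : (0 : ℝ) < #A := hN.trans_le hA
  have h := walkProb_card_visited_lt_le hG hmix (M := M) hε0 hε1
    (σ := τ * r + M * (2 / Fintype.card V)) (by positivity)
    (fun k hk e he => (walkExp_count_self_le hG hmix hε0 hε1 hr hreturn k he).trans (by gcongr))
    (A := A) rfl (by positivity) he
  rw [show (M : ℝ) / (4 * Fintype.card V) * #A = M * (#A / Fintype.card V) / 4 by field_simp]
  exact h.trans (by unfold phaseError; gcongr)

variable {n q : ℕ}

lemma one_sub_le_nonBacktrackingProb (hG : G.IsRegularOfDegree (q + 1)) (hq : 1 ≤ q) {k j m : ℕ}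
    {a b : ℝ} (ha : a ≤ j) (hb : (m : ℝ) + 1 ≤ b) (w₀ : V) :
    1 - (walkProb G (k + 1) (w₀, w₀) (fun l => ∃ x, m < l.count x) +
        walkProb G (k + 1) (w₀, w₀) (fun l => ∀ x, l.count x < j)) ≤
      nonBacktrackingProb G w₀ (k + 1)
        fun w => a ≤ (maxVisits w : ℝ) ∧ (maxVisits w : ℝ) ≤ b := by
  set Q : List V → Prop := fun l => a ≤ ((univ.sup fun v => l.count v : ℕ) : ℝ) ∧
    ((univ.sup fun v => l.count v : ℕ) : ℝ) ≤ b
  have hmax : (fun w : Fin (k + 1 + 1) → V => a ≤ (maxVisits w : ℝ) ∧ (maxVisits w : ℝ) ≤ b) =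
      fun w => Q (List.ofFn w) := by
    simp only [Q, maxVisits, visits_eq_count]
  have hdeg : ∀ v, 2 ≤ G.degree v := fun v => by rw [hG v]; lia
  rw [hmax, nonBacktrackingProb_eq_walkProb hG hq, sub_le_iff_le_add,
    ← walkProb_add_walkProb_not hdeg (k + 1) (w₀, w₀) fun l => Q (w₀ :: l)]
  gcongr
  refine (walkProb_mono fun l _ _ hnot => ?_).trans (walkProb_or_le _ _ _ _)
  by_contra! h
  obtain ⟨hle, x, hx⟩ := h
  refine hnot ⟨ha.trans (Nat.cast_le.2 (hx.trans ?_)), le_trans ?_ hb⟩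
  · exact List.count_le_count_cons.trans (le_sup (f := fun v => (w₀ :: l).count v) (mem_univ x))
  · have : (univ.sup fun v => (w₀ :: l).count v) ≤ m + 1 := Finset.sup_le fun v _ => by
      rw [List.count_cons]
      have := hle v
      split_ifs <;> lia
    exact_mod_cast this

lemma one_sub_le_nonBacktrackingProb_of_isMixingTime (hG : G.IsRegularOfDegree (q + 1))
    (hq : 1 ≤ q) (hmix : IsMixingTime G τ ε) (hε0 : 0 ≤ ε) (hε1 : ε ≤ 1) (hr : 0 ≤ r)
    (hreturn : ∀ t ≠ 0, ∀ e : V × V, G.Adj e.1 e.2 → hitProb G t e {e.2} ≤ r)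
    {θ N a b : ℝ} {j m : ℕ} (hθ : 0 < θ) (hN : 0 < N) (hM : 0 < M) (hMn : M ≤ Fintype.card V)
    (hj : j * (τ + M) + 1 ≤ n)
    (hNj : N ≤ ((M : ℝ) / (4 * Fintype.card V)) ^ j * Fintype.card V)
    (ha : a ≤ j) (hb : (m : ℝ) + 1 ≤ b) (w₀ : V) :
    1 - (n * ((1 + θ) ^ n * (τ * r + 2 / Fintype.card V / θ) ^ m) +
        j * phaseError (Fintype.card V) τ M ε r N) ≤
      nonBacktrackingProb G w₀ n fun w => a ≤ (maxVisits w : ℝ) ∧ (maxVisits w : ℝ) ≤ b := by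
  have hdeg : ∀ v, 2 ≤ G.degree v := fun v => by rw [hG v]; lia
  have hκ1 : (M : ℝ) / (4 * Fintype.card V) ≤ 1 := by
    have : (M : ℝ) ≤ Fintype.card V := by exact_mod_cast hMn
    exact div_le_one_of_le₀ (by linarith) (by positivity)
  have hζ0 : 0 ≤ phaseError (Fintype.card V) τ M ε r N := by unfold phaseError; positivity
  have hfew := walkProb_forall_count_lt_le hdeg (by positivity) hκ1 hN hζ0
    (fun e he A hA => walkProb_card_visited_lt_le_phaseError hdeg hmix hε0 hε1 hr hreturn hM hN
      hA he) hj hNj (w₀, w₀)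
  have hmany := walkProb_exists_lt_count_le_of_isMixingTime hdeg hmix hε0 hε1 hr hreturn hθ m n
    (w₀, w₀)
  obtain ⟨k, rfl⟩ := Nat.exists_eq_succ_of_ne_zero (by lia : n ≠ 0)
  exact (sub_le_sub_left (add_le_add hmany hfew) 1).trans
    (one_sub_le_nonBacktrackingProb hG hq ha hb w₀)

end Finitary

/-! ### The choice of the parameters -/

section Parameters

lemma tendsto_log_natCast_atTop : Tendsto (fun n : ℕ => Real.log n) atTop atTop :=
  Real.tendsto_log_atTop.comp tendsto_natCast_atTop_atTop

lemma eventually_log_le_mul {c : ℝ} (hc : 0 < c) : ∀ᶠ x : ℝ in atTop, Real.log x ≤ c * x := by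
  filter_upwards [Real.isLittleO_log_id_atTop.bound hc, eventually_ge_atTop 0] with x hx hx0
  rw [id, Real.norm_of_nonneg hx0] at hx
  exact (Real.le_norm_self _).trans hx

lemma eventually_log_const_mul_le_mul {a c : ℝ} (ha : 0 < a) (hc : 0 < c) :
    ∀ᶠ x : ℝ in atTop, Real.log (a * x) ≤ c * x := by
  filter_upwards [(tendsto_id.const_mul_atTop ha).eventually
    (eventually_log_le_mul (div_pos hc ha))] with x hx
  calc Real.log (a * x) ≤ c / a * (a * x) := hx
    _ = c * x := by field_simp

lemma eventually_mul_sq_log_le {c : ℝ} (hc : 0 < c) :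
    ∀ᶠ n : ℕ in atTop, c * Real.log n ^ 2 ≤ n := by
  filter_upwards [tendsto_natCast_atTop_atTop.eventually
    ((Real.isLittleO_pow_log_id_atTop (n := 2)).bound (inv_pos.2 hc))] with n hn
  rwa [inv_mul_eq_div, le_div_iff₀' hc, id, Real.norm_of_nonneg (by positivity),
    Real.norm_natCast] at hn

lemma eventually_exp_mul_exp_mul_pow_le {δ c η : ℝ} (hδ0 : 0 < δ) (hδ1 : δ ≤ 1) (hc : 0 < c)
    (hη : 0 < η) :
    ∀ᶠ ℓ : ℝ in atTop, ∀ (β : ℝ) (m : ℕ), 0 ≤ β → β ≤ c * Real.log ℓ / ℓ →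
      (1 + δ) * (ℓ / Real.log ℓ) ≤ m + 2 →
      Real.exp ℓ * (Real.exp (ℓ / Real.log ℓ) * β ^ m) ≤ η := by
  have hexp : Tendsto (fun ℓ : ℝ => Real.exp (-(δ / 8 * ℓ))) atTop (nhds 0) :=
    Real.tendsto_exp_neg_atTop_nhds_zero.comp (tendsto_id.const_mul_atTop (by positivity))
  filter_upwards [eventually_gt_atTop 0, Real.tendsto_log_atTop.eventually_gt_atTop 0,
    Real.tendsto_log_atTop.eventually_ge_atTop (8 / δ),
    Real.tendsto_log_atTop.eventually (eventually_log_const_mul_le_mul hc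
      (by positivity : 0 < δ / 4)),
    eventually_log_le_mul (by positivity : 0 < δ / 8), hexp.eventually_le_const hη]
    with ℓ hℓ hy hyδ hlogy hyℓ hη β m hβ0 hβ hm
  set y := Real.log ℓ with hy_def
  have hβexp : β ≤ Real.exp (-((1 - δ / 4) * y)) := by
    refine hβ.trans ?_
    rw [← Real.log_le_iff_le_exp (by positivity), Real.log_div (by positivity) hℓ.ne']
    linarith
  have hexponent : ℓ + (ℓ / y + m * -((1 - δ / 4) * y)) ≤ -(δ / 8 * ℓ) := by
    have hmy : (1 - δ / 4) * ((1 + δ) * ℓ) ≤ (1 - δ / 4) * ((m + 2) * y) := by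
      rw [mul_div_assoc', div_le_iff₀ hy] at hm
      exact mul_le_mul_of_nonneg_left hm (by linarith)
    have hLℓ : ℓ / y ≤ δ / 8 * ℓ := by
      rw [div_le_iff₀ hδ0] at hyδ
      rw [div_le_iff₀ hy]
      nlinarith
    have hgain : 0 ≤ δ / 4 * (1 - δ) * ℓ := by
      have : 0 ≤ 1 - δ := by linarith
      positivity
    have : 0 ≤ δ * y := by positivity
    linarith
  calc Real.exp ℓ * (Real.exp (ℓ / y) * β ^ m)
      ≤ Real.exp ℓ * (Real.exp (ℓ / y) * Real.exp (-((1 - δ / 4) * y)) ^ m) := by gcongr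
    _ = Real.exp (ℓ + (ℓ / y + m * -((1 - δ / 4) * y))) := by
        rw [Real.exp_add, Real.exp_add, Real.exp_nat_mul]
    _ ≤ Real.exp (-(δ / 8 * ℓ)) := Real.exp_le_exp.2 hexponent
    _ ≤ η := hη

lemma eventually_exists_upperTail_le {δ B D η : ℝ} (hδ0 : 0 < δ) (hδ1 : δ ≤ 1) (hB : 0 ≤ B)
    (hD : 0 ≤ D) (hη : 0 < η) :
    ∀ᶠ n : ℕ in atTop, ∃ (m : ℕ) (θ : ℝ), 0 < θ ∧
      (m : ℝ) + 1 ≤ (1 + δ) * (Real.log n / Real.log (Real.log n)) ∧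
      ∀ τ : ℕ, (τ : ℝ) ≤ B * Real.log n →
        n * ((1 + θ) ^ n * (τ * (D / Real.log n ^ 2) + 2 / n / θ) ^ m) ≤ η := by
  filter_upwards [tendsto_log_natCast_atTop.eventually (eventually_exp_mul_exp_mul_pow_le hδ0 hδ1
      (by positivity : 0 < B * D + 2) hη), eventually_gt_atTop 0,
    tendsto_log_natCast_atTop.eventually_gt_atTop 0,
    tendsto_log_natCast_atTop.eventually (Real.tendsto_log_atTop.eventually_ge_atTop 1)]
    with n htail hn hℓ hy
  set ℓ := Real.log n with hℓ_def
  set y := Real.log ℓ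
  have hn : (0 : ℝ) < n := by exact_mod_cast hn
  have hL : 1 ≤ ℓ / y := (one_le_div (by linarith)).2 (Real.log_le_self hℓ.le)
  have hfloor : 1 ≤ ⌊(1 + δ) * (ℓ / y)⌋₊ := Nat.le_floor (by push_cast; nlinarith)
  refine ⟨⌊(1 + δ) * (ℓ / y)⌋₊ - 1, ℓ / y / n, by positivity, ?_, fun τ hτ => ?_⟩
  · rw [Nat.cast_sub hfloor, Nat.cast_one, sub_add_cancel]
    exact Nat.floor_le (by positivity)
  have hβ : τ * (D / ℓ ^ 2) + 2 / n / (ℓ / y / n) ≤ (B * D + 2) * y / ℓ := by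
    calc τ * (D / ℓ ^ 2) + 2 / n / (ℓ / y / n) ≤ B * ℓ * (D / ℓ ^ 2) + 2 / n / (ℓ / y / n) := by
          gcongr
      _ = (B * D * 1 + 2 * y) / ℓ := by field_simp
      _ ≤ (B * D * y + 2 * y) / ℓ := by gcongr
      _ = (B * D + 2) * y / ℓ := by ring
  refine le_trans ?_ (htail _ (⌊(1 + δ) * (ℓ / y)⌋₊ - 1) (by positivity) hβ ?_)
  · rw [hℓ_def, Real.exp_log hn]
    gcongr
    simpa [neg_div] using Real.one_sub_div_pow_le_exp_neg (n := n) (t := -(ℓ / y)) (by linarith)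
  · rw [Nat.cast_sub hfloor, Nat.cast_one]
    linarith [Nat.lt_floor_add_one ((1 + δ) * (ℓ / y))]

lemma eventually_pow_le_pow_mul_exp {δ : ℝ} (hδ : 0 < δ) (a : ℕ) :
    ∀ᶠ ℓ : ℝ in atTop, ∀ (κ : ℝ) (j : ℕ), 1 / ℓ ≤ κ → j ≤ (1 - δ) * (ℓ / Real.log ℓ) + 1 →
      ℓ ^ a ≤ κ ^ j * Real.exp ℓ := by
  filter_upwards [eventually_gt_atTop 0, Real.tendsto_log_atTop.eventually_gt_atTop 0,
    eventually_log_le_mul (by positivity : 0 < δ / (a + 1))] with ℓ hℓ hy hyℓ κ j hκ hj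
  set y := Real.log ℓ with hy_def
  have hexp : Real.exp y = ℓ := Real.exp_log hℓ
  have hexponent : a * y ≤ j * -y + ℓ := by
    have hjy : j * y ≤ (1 - δ) * ℓ + y := by
      calc j * y ≤ ((1 - δ) * (ℓ / y) + 1) * y := by gcongr
        _ = (1 - δ) * ℓ + y := by field_simp
    rw [div_mul_eq_mul_div, le_div_iff₀ (by positivity)] at hyℓ
    linarith
  calc ℓ ^ a = Real.exp (a * y) := by rw [Real.exp_nat_mul, hexp]
    _ ≤ Real.exp (j * -y + ℓ) := Real.exp_le_exp.2 hexponent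
    _ = (1 / ℓ) ^ j * Real.exp ℓ := by
        rw [Real.exp_add, Real.exp_nat_mul, Real.exp_neg, hexp, one_div]
    _ ≤ κ ^ j * Real.exp ℓ := by gcongr

lemma mul_phaseError_le {n ℓ L K B D : ℝ} {τ M j : ℕ} (hℓ : 1 ≤ ℓ) (hL0 : 0 < L) (hL : L ≤ ℓ)
    (hK : 0 < K) (hB : 0 ≤ B) (hD : 0 ≤ D) (hn : ℓ ^ 2 ≤ n) (hj : j ≤ L)
    (hτ : τ ≤ B * ℓ) (hM : n / (L * K) / 2 ≤ M) (hM' : M ≤ n / (L * K)) :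
    j * phaseError n τ M (1 / n) (D / ℓ ^ 2) (ℓ ^ 4) ≤
      (16 * (1 + 2 * B) * K + 20) / ℓ + 8 * B * D * L / ℓ + 16 / K := by
  have hn0 : 0 < n := lt_of_lt_of_le (by positivity) hn
  have hjℓ : (j : ℝ) ≤ ℓ := hj.trans hL
  have hmixing : j * (8 * (1 + 2 * τ) / (M * (ℓ ^ 4 / n))) ≤ 16 * (1 + 2 * B) * K / ℓ := by
    have hτ' : 1 + 2 * (τ : ℝ) ≤ (1 + 2 * B) * ℓ := by linarith
    calc j * (8 * (1 + 2 * τ) / (M * (ℓ ^ 4 / n)))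
        ≤ ℓ * (8 * ((1 + 2 * B) * ℓ) / (n / (L * K) / 2 * (ℓ ^ 4 / n))) := by gcongr
      _ = 16 * (1 + 2 * B) * K * L / ℓ ^ 2 := by field_simp; ring
      _ ≤ 16 * (1 + 2 * B) * K * ℓ / ℓ ^ 2 := by gcongr
      _ = 16 * (1 + 2 * B) * K / ℓ := by field_simp
  have hbias : j * (20 * (1 / n)) ≤ 20 / ℓ := by
    calc j * (20 * (1 / n)) ≤ ℓ * (20 * (1 / ℓ ^ 2)) := by gcongr
      _ = 20 / ℓ := by field_simp
  have hearly : j * (8 * (τ * (D / ℓ ^ 2))) ≤ 8 * B * D * L / ℓ := by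
    calc j * (8 * (τ * (D / ℓ ^ 2))) ≤ L * (8 * (B * ℓ * (D / ℓ ^ 2))) := by gcongr
      _ = 8 * B * D * L / ℓ := by field_simp
  have hlate : j * (8 * (M * (2 / n))) ≤ 16 / K := by
    calc j * (8 * (M * (2 / n))) ≤ L * (8 * (n / (L * K) * (2 / n))) := by gcongr
      _ = 16 / K := by field_simp; norm_num
  rw [phaseError, add_div]
  linarith

lemma eventually_mul_phaseError_le {B D K η : ℝ} (hB : 0 ≤ B) (hD : 0 ≤ D) (hK : 0 < K)
    (hη : 16 / K < η) :
    ∀ᶠ n : ℕ in atTop, ∀ τ M j : ℕ, (j : ℝ) ≤ Real.log n / Real.log (Real.log n) →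
      τ ≤ B * Real.log n → n / (Real.log n / Real.log (Real.log n) * K) / 2 ≤ M →
      M ≤ n / (Real.log n / Real.log (Real.log n) * K) →
      j * phaseError n τ M (1 / n) (D / Real.log n ^ 2) (Real.log n ^ 4) ≤ η := by
  have hlim : Tendsto (fun ℓ => (16 * (1 + 2 * B) * K + 20) / ℓ + 8 * B * D / Real.log ℓ + 16 / K)
      atTop (nhds (0 + 0 + 16 / K)) :=
    ((tendsto_id.const_div_atTop _).add (Real.tendsto_log_atTop.const_div_atTop _)).add_const _
  rw [zero_add, zero_add] at hlim
  filter_upwards [tendsto_log_natCast_atTop.eventually (hlim.eventually_le_const hη),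
    tendsto_log_natCast_atTop.eventually_ge_atTop 1,
    (Real.tendsto_log_atTop.comp tendsto_log_natCast_atTop).eventually_ge_atTop 1,
    eventually_mul_sq_log_le zero_lt_one]
    with n hn hℓ hy hsq τ M j hj hτ hM hM'
  set ℓ := Real.log n
  have hy : 1 ≤ Real.log ℓ := hy
  rw [one_mul] at hsq
  refine (mul_phaseError_le hℓ (by positivity) (div_le_self (by positivity) hy) hK hB hD hsq
    hj hτ hM hM').trans (le_of_eq_of_le ?_ hn)
  field_simp

lemma mul_add_add_one_le {n : ℕ} {ℓ L K C : ℝ} {τ M j : ℕ} (hC : 0 < C) (hℓ : 1 ≤ ℓ) (hL0 : 0 < L)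
    (hL : L ≤ ℓ) (hK : 4 ≤ K) (hj : j ≤ L) (hτ : τ ≤ 2 * C * ℓ) (hM : M ≤ n / (L * K))
    (hn : (8 * C + 4) * ℓ ^ 2 ≤ n) : j * (τ + M) + 1 ≤ n := by
  have : (j : ℝ) * (τ + M) + 1 ≤ n := by
    calc (j : ℝ) * (τ + M) + 1 ≤ L * (2 * C * ℓ + n / (L * K)) + 1 := by gcongr
      _ = 2 * C * (L * ℓ) + n / K + 1 := by field_simp
      _ ≤ 2 * C * (ℓ * ℓ) + n / 4 + ℓ ^ 2 := by gcongr; exact one_le_pow₀ hℓ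
      _ ≤ n := by linarith
  exact_mod_cast this

lemma one_div_le_div_four_mul {n ℓ x M : ℝ} (hn : 0 < n) (hx : 0 < x) (hxℓ : 8 * x ≤ ℓ)
    (hM : n / x / 2 ≤ M) : 1 / ℓ ≤ M / (4 * n) := by
  calc 1 / ℓ ≤ 1 / (8 * x) := by gcongr
    _ = n / x / 2 / (4 * n) := by field_simp; norm_num
    _ ≤ M / (4 * n) := by gcongr

lemma eventually_exists_phases {δ C D : ℝ} (hδ0 : 0 < δ) (hδ1 : δ ≤ 1) (hC : 0 < C)
    (hD : 0 ≤ D) :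
    ∀ᶠ n : ℕ in atTop, ∃ τ M j : ℕ, C * Real.log n ≤ τ ∧ τ ≤ 2 * C * Real.log n ∧
      0 < M ∧ M ≤ n ∧ j * (τ + M) + 1 ≤ n ∧
      (1 - δ) * (Real.log n / Real.log (Real.log n)) ≤ j ∧
      Real.log n ^ 4 ≤ ((M : ℝ) / (4 * n)) ^ j * n ∧
      j * phaseError n τ M (1 / n) (D / Real.log n ^ 2) (Real.log n ^ 4) ≤ δ / 2 := by
  set K : ℝ := 64 / δ with hK
  have hK4 : 4 ≤ K := by rw [hK, le_div_iff₀ hδ0]; linarith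
  have herr := eventually_mul_phaseError_le (B := 2 * C) (by positivity) hD (by positivity)
    (by rw [hK]; field_simp; norm_num : 16 / K < δ / 2)
  filter_upwards [herr, eventually_mul_sq_log_le (by positivity : 0 < 8 * C + 4),
    tendsto_log_natCast_atTop.eventually_ge_atTop (max 1 (1 / C)),
    (Real.tendsto_log_atTop.comp tendsto_log_natCast_atTop).eventually_ge_atTop (8 * K),
    tendsto_log_natCast_atTop.eventually (eventually_log_le_mul hδ0),
    tendsto_log_natCast_atTop.eventually (eventually_pow_le_pow_mul_exp hδ0 4)]
    with n herr hsq hℓ hy hyℓ hpow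
  set ℓ := Real.log n with hℓ_def
  set L := ℓ / Real.log ℓ with hL_def
  have hy : 8 * K ≤ Real.log ℓ := hy
  have hℓ1 : 1 ≤ ℓ := (le_max_left _ _).trans hℓ
  have hCℓ : 1 ≤ C * ℓ := (div_le_iff₀' hC).1 ((le_max_right _ _).trans hℓ)
  have hn : (0 : ℝ) < n := lt_of_lt_of_le (by positivity) hsq
  have hL : 1 ≤ L := (one_le_div (by linarith)).2 (Real.log_le_self (by positivity))
  have hLℓ : L ≤ ℓ := div_le_self (by positivity) (by linarith)
  have hδL : 1 ≤ δ * L := by rwa [hL_def, mul_div_assoc', one_le_div (by linarith)]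
  have hLK : 8 * (L * K) ≤ ℓ := by
    rw [hL_def, div_mul_eq_mul_div, mul_div_assoc', div_le_iff₀ (by linarith)]
    nlinarith
  have hLK1 : 1 ≤ L * K := by nlinarith
  have hx : 1 ≤ n / (L * K) := by
    rw [one_le_div (by positivity)]
    linarith [Real.log_le_self hn.le]
  have hτ : (⌈C * ℓ⌉₊ : ℝ) ≤ 2 * C * ℓ := by
    linarith [Nat.ceil_lt_two_mul (by linarith : 2⁻¹ < C * ℓ)]
  have hM' := (Nat.div_two_lt_floor hx).le
  have hM := Nat.floor_le (zero_le_one.trans hx)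
  have hj : (⌈(1 - δ) * L⌉₊ : ℝ) ≤ (1 - δ) * L + 1 :=
    (Nat.ceil_lt_add_one (mul_nonneg (by linarith) (by positivity))).le
  refine ⟨⌈C * ℓ⌉₊, ⌊n / (L * K)⌋₊, ⌈(1 - δ) * L⌉₊, Nat.le_ceil _, hτ, Nat.floor_pos.2 hx, ?_, ?_,
    Nat.le_ceil _, ?_, herr _ _ _ (by linarith) hτ hM' hM⟩
  · exact_mod_cast hM.trans (div_le_self hn.le hLK1)
  · exact mul_add_add_one_le hC hℓ1 (by linarith) hLℓ hK4 (by linarith) hτ hM hsq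
  · have := hpow _ _ (one_div_le_div_four_mul hn (by positivity) hLK hM') hj
    rwa [hℓ_def, Real.exp_log hn] at this

end Parameters

section Concentration

/-- On all `(q + 1)`-regular graphs with `n` vertices, second eigenvalue at most `lam₀` and girth
at least `4 log_q (log n)`, the maximal number of visits is within a factor `1 ± δ` of
`log n / log log n` with probability at least `1 - δ`. One `δ` plays both roles, so that the
asymptotic statement comes down to a single sequence of values of `δ`. -/
def MaxVisitsConcentrated (q : ℕ) (lam₀ δ : ℝ) (n : ℕ) : Prop :=
  ∀ (V : Type*) [Fintype V] [DecidableEq V] (G : SimpleGraph V) [DecidableRel G.Adj] (lam : ℝ),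
    lam ≤ lam₀ → IsNDLGraph G n (q + 1) lam →
    4 * Real.logb q (Real.log n) ≤ (G.girth : ℝ) →
    ∀ w₀ : V,
      1 - δ ≤ nonBacktrackingProb G w₀ n (fun w =>
        (1 - δ) * (Real.log n / Real.log (Real.log n)) ≤ (maxVisits w : ℝ) ∧
        (maxVisits w : ℝ) ≤ (1 + δ) * (Real.log n / Real.log (Real.log n)))

lemma maxVisitsConcentrated_one (q : ℕ) (lam₀ : ℝ) (n : ℕ) : MaxVisitsConcentrated q lam₀ 1 n :=
  fun _ _ _ _ _ _ _ _ _ _ => by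
    rw [sub_self]
    exact div_nonneg (Nat.cast_nonneg _) (Nat.cast_nonneg _)

lemma eventually_maxVisitsConcentrated {q : ℕ} (hq : 2 ≤ q) {lam₀ : ℝ} (hlam₀ : lam₀ < q + 1)
    {δ : ℝ} (hδ0 : 0 < δ) (hδ1 : δ ≤ 1) : ∀ᶠ n in atTop, MaxVisitsConcentrated q lam₀ δ n := by
  obtain ⟨C, hC, hmix⟩ := exists_eventually_isMixingTime hq hlam₀
  filter_upwards [hmix, tendsto_log_natCast_atTop.eventually_gt_atTop 1, eventually_ge_atTop 1,
    eventually_exists_upperTail_le hδ0 hδ1 (by positivity : 0 ≤ 2 * C) q.cast_nonneg (half_pos hδ0),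
    eventually_exists_phases hδ0 hδ1 hC q.cast_nonneg]
    with n hmix hℓ hn ⟨m, θ, hθ, hb, hupper⟩ ⟨τ, M, j, hτ, hτ', hM, hMn, hj, ha, hNj, hlower⟩
  intro V _ _ G _ lam hlam hG hgirth w₀
  have hreturn : ∀ t ≠ 0, ∀ e : V × V, G.Adj e.1 e.2 →
      hitProb G t e {e.2} ≤ q / Real.log n ^ 2 := by
    have hgirth' : 2 * Real.logb q (Real.log n ^ 2) ≤ G.girth := by
      rw [Real.logb_pow]
      push_cast
      linarith
    exact fun t ht e he =>
      hitProb_return_le hG.2.1 hq (one_lt_pow₀ hℓ two_ne_zero) hgirth' he ht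
  have hτmix := hmix V G lam hlam hG τ hτ
  obtain ⟨rfl, hreg, -⟩ := hG
  refine le_trans ?_ (one_sub_le_nonBacktrackingProb_of_isMixingTime hreg (by lia) hτmix
    (by positivity) (div_le_one_of_le₀ (by exact_mod_cast hn) (by positivity)) (by positivity)
    hreturn hθ (by positivity) hM hMn hj hNj ha hb w₀)
  linarith [hupper τ hτ']

lemma exists_tendsto_zero_of_eventually {P : ℝ → ℕ → Prop} (h1 : ∀ n, P 1 n)
    (h : ∀ δ, 0 < δ → δ ≤ 1 → ∀ᶠ n in atTop, P δ n) :
    ∃ δ : ℕ → ℝ, Tendsto δ atTop (nhds 0) ∧ ∀ n, P (δ n) n := by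
  have hthreshold : ∀ k : ℕ, ∃ N : ℕ, (k = 0 → N = 0) ∧ ∀ n, N ≤ n → P (1 / ((k : ℝ) + 1)) n := by
    intro k
    rcases Nat.eq_zero_or_pos k with rfl | hk
    · exact ⟨0, fun _ => rfl, fun n _ => by simpa using h1 n⟩
    · obtain ⟨N, hN⟩ := eventually_atTop.1
        (h (1 / ((k : ℝ) + 1)) Nat.one_div_pos_of_nat (div_le_one_of_le₀ (by simp) (by positivity)))
      exact ⟨N, fun h0 => absurd h0 hk.ne', hN⟩
  choose N hN0 hN using hthreshold
  let k : ℕ → ℕ := fun n => Nat.findGreatest (fun k => N k ≤ n) n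
  have hk : ∀ n, N (k n) ≤ n := fun n =>
    Nat.findGreatest_spec (P := fun k => N k ≤ n) (Nat.zero_le n) (by simp [hN0 0 rfl])
  have hk_tendsto : Tendsto k atTop atTop := by
    refine tendsto_atTop.2 fun K => ?_
    filter_upwards [eventually_ge_atTop (max K (N K))] with n hn
    exact Nat.le_findGreatest ((le_max_left _ _).trans hn) ((le_max_right _ _).trans hn)
  exact ⟨fun n => 1 / ((k n : ℝ) + 1), tendsto_one_div_add_atTop_nhds_zero_nat.comp hk_tendsto,
    fun n => hN _ _ (hk n)⟩

end Concentration

end NonBacktracking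

theorem theorem2_general (d : ℕ) (hd : 3 ≤ d) (lam₀ : ℝ) (hlam₀ : lam₀ < d) :
    ∃ δ η : ℕ → ℝ,
      Filter.Tendsto δ Filter.atTop (nhds 0) ∧ Filter.Tendsto η Filter.atTop (nhds 0) ∧
      ∀ (V : Type*) [Fintype V] [DecidableEq V] (G : SimpleGraph V) [DecidableRel G.Adj]
        (n : ℕ) (lam : ℝ), lam ≤ lam₀ → IsNDLGraph G n d lam →
        4 * Real.logb ((d : ℝ) - 1) (Real.log n) ≤ (G.girth : ℝ) →
        ∀ w₀ : V,
          1 - η n ≤ nonBacktrackingProb G w₀ n (fun w =>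
            (1 - δ n) * (Real.log n / Real.log (Real.log n)) ≤ (maxVisits w : ℝ) ∧
            (maxVisits w : ℝ) ≤ (1 + δ n) * (Real.log n / Real.log (Real.log n))) := by
  obtain ⟨q, rfl⟩ := Nat.exists_eq_add_of_le' (by lia : 1 ≤ d)
  rw [Nat.cast_add_one] at hlam₀
  obtain ⟨δ, hδ, hP⟩ := NonBacktracking.exists_tendsto_zero_of_eventually
    (NonBacktracking.maxVisitsConcentrated_one q lam₀)
    fun _ => NonBacktracking.eventually_maxVisitsConcentrated (by lia) hlam₀
  refine ⟨δ, δ, hδ, hδ, fun V _ _ G _ n lam hlam hG hgirth w₀ => hP n V G lam hlam hG ?_ w₀⟩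
  rwa [Nat.cast_add_one, add_sub_cancel_right] at hgirth

theorem theorem2 (d : ℕ) (hd : 3 ≤ d) (lam₀ : ℝ) (hlam₀ : lam₀ < d) :
    ∃ δ η : ℕ → ℝ,
      Filter.Tendsto δ Filter.atTop (nhds 0) ∧ Filter.Tendsto η Filter.atTop (nhds 0) ∧
      ∀ (V : Type*) [Fintype V] [DecidableEq V] (G : SimpleGraph V) [DecidableRel G.Adj]
        (n : ℕ) (lam : ℝ), lam ≤ lam₀ → IsNDLGraph G n d lam →
        10 * Real.logb ((d : ℝ) - 1) (Real.log n) ≤ (G.girth : ℝ) →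
        ∀ w₀ : V,
          1 - η n ≤ nonBacktrackingProb G w₀ n (fun w =>
            (1 - δ n) * (Real.log n / Real.log (Real.log n)) ≤ (maxVisits w : ℝ) ∧
            (maxVisits w : ℝ) ≤ (1 + δ n) * (Real.log n / Real.log (Real.log n))) := by
  obtain ⟨δ, η, hδ, hη, h⟩ := theorem2_general d hd lam₀ hlam₀
  exact ⟨δ, η, hδ, hη, fun V _ _ G _ n lam hlam hG hgirth =>
    h V G n lam hlam hG (by linarith [(Nat.cast_nonneg G.girth : (0 : ℝ) ≤ G.girth)])⟩
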